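/- Let $k$ be a field of characteristic zero and let $q\in k^\times$, of order $m=o(q)\in\{1,2,\dots\}\cup\{\infty\}$. **Smash coproducts.** If a finite group $H$ acts by automorphisms on a group $\Gamma$, then $k[\Gamma]\rtimes k^H$ denotes the Hopf algebra which is $k[\Gamma]\otimes k^H$ as an algebra (with basis $r\#\delta_h$, $r\in\Gamma$, $h\in H$), and $$\Delta(r\#\delta_h)=\sum_{l\in H} r\#\delta_{l^{-1}}\otimes l.r\#\delta_{lh},\qquad \varepsilon(r\#\delta_h)=\delta_{h,1},\qquad S(r\#\delta_h)=h^{-1}.r^{-1}\#\delta_{h^{-1}}.$$ Suppose moreover that $N\lhd\Gamma$ is a normal $H$-stable subgroup and that $\Phi:N\to (k^H)^\times$ is a group morphism with $\Phi(r)(lh)=\Phi(l^{-1}.r)(h)\,\Phi(r)(l)$ and $\Phi(srs^{-1})=\Phi(r)$ for $r\in N$, $s\in\Gamma$, $h,l\in H$. Let $j:\Gamma/N\to\Gamma$ be a section of the projection with $j(1)=1$. Then $k[\Gamma/N]\rtimes_\Phi k^H$ denotes the Hopf algebra $k[\Gamma/N]\otimes k^H$ with the obvious unit and counit and, for $a,b\in\Gamma/N$,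 $h,h'\in H$, $$(a\#\delta_h)(b\#\delta_{h'})=ab\#\delta_h\delta_{h'}\Phi(j(a)j(b)j(ab)^{-1}),$$ $$\Delta(a\#\delta_h)=\sum_{l\in H}a\#\delta_{l^{-1}}\otimes l.a\#\delta_{lh}\Phi(l.j(a)\,j(l.a)^{-1}),$$ $$S(a\#\delta_h)=h^{-1}.a^{-1}\#\Phi\big(j(h^{-1}.a^{-1})^{-1}\,h^{-1}.j(a)^{-1}\big)\delta_{h^{-1}}.$$ Up to isomorphism it does not depend on $j$. **The objects.** Let $\Gamma_{2,2}=\langle g_0,g_1\mid g_0^2=g_1^2=1,\ [g_{i_1}g_{i_2},g_{j_1}g_{j_2}]=1\rangle$ $(=\mathbb Z_2*\mathbb Z_2)$, with the action of $\mathbb Z_2=\langle h\rangle$ exchanging $g_0$ and $g_1$. For $n\ge1$ let $N_n=\langle (g_0g_1)^n\rangle$, an infinite cyclic, normal, $\mathbb Z_2$-stable subgroup, and let $\Phi_n:N_n\to(k^{\mathbb Z_2})^\times$ be the group morphism sending $(g_0g_1)^n$ to the character $\chi$ of $\mathbb Z_2$ with $\chi(h)=-1$. Put $$A(n)=k[\Gamma_{2,2}/N_n]\rtimes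 k^{\mathbb Z_2},\qquad B(n)=k[\Gamma_{2,2}/N_n]\rtimes_{\Phi_n}k^{\mathbb Z_2}.$$ Let $Q=\begin{pmatrix}1&1\\1&q\end{pmatrix}$ and $\theta_{ic}=\dfrac{Q_{i-1,c}\,Q_{i,c-1}}{Q_{ic}\,Q_{i-1,c-1}}$ for $i,c\in\mathbb Z/2$, so that $\theta=\begin{pmatrix}q^{-1}&q\\q&q^{-1}\end{pmatrix}$. Let $\varepsilon_0,\varepsilon_1$ be the canonical basis of $k^2$, and let $$\rho_q:k[\Gamma_{2,2}]\rtimes k^{\mathbb Z_2}\to \mathrm{End}(k^2)\simeq M_2(k)$$ be the algebra map with $\rho_q(g_i\#1)(\varepsilon_c)=\theta_{ic}\,\varepsilon_{c-1}$ and $\rho_q(1\#f)=f(h)\,\mathrm{id}$ for $f\in k^{\mathbb Z_2}$. **Hopf images.** The Hopf image of an algebra map $\rho:A\to R$ from a Hopf algebra $A$ to an algebra $R$ is the final object among factorizations $\rho=\varphi\circ p$ with $p:A\to L$ a surjective Hopf algebra map and $\varphi:L\to R$ an algebra map; that is, for every other such factorization $\rho=\psi\circ p'$ through $p':A\to L'$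 there is a unique Hopf algebra map $f:L'\to L$ with $f\circ p'=p$ and $\varphi\circ f=\psi$. **Proposition.** The Hopf image $A_q$ of $\rho_q$ exists, and, as Hopf algebras: 1. if $m=\infty$, then $A_q\simeq k[\Gamma_{2,2}]\rtimes k^{\mathbb Z_2}$; 2. if $m$ is odd, then $A_q\simeq A(m)$; 3. if $m\equiv 2 \pmod 4$, then $A_q\simeq A(m/2)$; 4. if $4\mid m$, then $A_q\simeq B(m/4)$. Moreover $\dim_k A_q=4\,o(q^4)$ (both sides being infinite when $m=\infty$). -/

import Mathlib

open scoped TensorProduct commutatorElement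

universe u v

noncomputable section

/-- Structure constants for a Hopf algebra on the vector space `k[Q] ⊗ k^H` with basis
`a # δ_h` (`a ∈ Q`, `h ∈ H`), where the group `H` acts by automorphisms on the group `Q`:

* `(a # δ_h) (b # δ_h') = σ a b h • (a b # δ_h)` if `h = h'`, and `0` otherwise,
* `Δ (a # δ_h) = ∑ l, τ l a (l h) • (a # δ_{l⁻¹}) ⊗ (l.a # δ_{l h})`,
* `S (a # δ_h) = ν a h • (h⁻¹.a⁻¹ # δ_{h⁻¹})`.

The fields are the identities among the structure constants that express the Hopf algebra axioms.
The trivial constants give the smash coproduct, see `smashDatum`; the constants attached to a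
quotient datum are constructed in `QuotientDatum.cocycle`. -/
structure SmashCocycle (k : Type*) [Field k] {Q H : Type*} [Group Q] [Group H]
    (act : H →* MulAut Q) where
  σ : Q → Q → H → k
  τ : H → Q → H → k
  ν : Q → H → k
  σ_one_left : ∀ a h, σ 1 a h = 1
  σ_one_right : ∀ a h, σ a 1 h = 1
  σ_assoc : ∀ a b c h, σ a b h * σ (a * b) c h = σ b c h * σ a (b * c) h
  σ_counit : ∀ a b, σ a b 1 = 1
  τ_one_left : ∀ a h, τ 1 a h = 1
  τ_counit : ∀ l a, τ l a 1 = 1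
  τ_unit : ∀ l h, τ l 1 h = 1
  τ_coassoc : ∀ l m a h, τ l a (l * h) * τ m a (m * l⁻¹)
    = τ m a (m * h) * τ (l * m⁻¹) (act m a) (l * h)
  σ_τ : ∀ l a b h, σ a b h * τ l (a * b) (l * h)
    = τ l a (l * h) * τ l b (l * h) * (σ a b l⁻¹ * σ (act l a) (act l b) (l * h))
  ν_left : ∀ l a, τ l a l * ν a l⁻¹ * σ (act l a⁻¹) (act l a) l = 1
  ν_right : ∀ l a, τ l a l * ν (act l a) l * σ a a⁻¹ l⁻¹ = 1

section Hopf

variable {k Q H : Type*} [Field k] [Group Q] [Group H] {act : H →* MulAut Q}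

/-- The vector space with basis the elements `a # δ_h`, to be equipped with the Hopf algebra
structure whose structure constants are `c`. -/
def TwistedSmash (_c : SmashCocycle k act) := Q × H →₀ k

namespace TwistedSmash

variable (c : SmashCocycle k act)

instance : AddCommGroup (TwistedSmash c) := inferInstanceAs (AddCommGroup (Q × H →₀ k))

instance : Module k (TwistedSmash c) := inferInstanceAs (Module k (Q × H →₀ k))

/-- The basis `(a, h) ↦ a # δ_h`. -/
def basis : Module.Basis (Q × H) k (TwistedSmash c) := ⟨LinearEquiv.refl k (Q × H →₀ k)⟩

/-- The basis element `a # δ_h`. -/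
def elt (a : Q) (h : H) : TwistedSmash c := basis c (a, h)

/-- Linear maps out of `TwistedSmash c` from their values on the elements `a # δ_h`. -/
def lift {V : Type*} [AddCommGroup V] [Module k V] (f : Q → H → V) : TwistedSmash c →ₗ[k] V :=
  (basis c).constr k fun x => f x.1 x.2

@[simp]
theorem lift_elt {V : Type*} [AddCommGroup V] [Module k V] (f : Q → H → V) (a : Q) (h : H) :
    lift c f (elt c a h) = f a h := by
  simp [lift, elt, Module.Basis.constr_basis]

variable {c} in
theorem lin_ext {V : Type*} [AddCommGroup V] [Module k V] {f g : TwistedSmash c →ₗ[k] V}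
    (w : ∀ a h, f (elt c a h) = g (elt c a h)) : f = g :=
  (basis c).ext fun x => w x.1 x.2

variable [Fintype H] [DecidableEq H]

set_option linter.unusedSectionVars false

/-- The multiplication `(a # δ_h) (b # δ_h') = [h = h'] σ a b h • (a b # δ_h)`. -/
def mulMap : TwistedSmash c →ₗ[k] TwistedSmash c →ₗ[k] TwistedSmash c :=
  lift c fun a h => lift c fun b h' => if h = h' then c.σ a b h • elt c (a * b) h else 0

instance : Mul (TwistedSmash c) := ⟨fun x y => mulMap c x y⟩

/-- The unit is `1 # 1 = ∑ h, 1 # δ_h`. -/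
instance : One (TwistedSmash c) := ⟨∑ h, elt c 1 h⟩

theorem mul_def (x y : TwistedSmash c) : x * y = mulMap c x y := rfl

theorem one_def : (1 : TwistedSmash c) = ∑ h, elt c 1 h := rfl

theorem elt_mul_elt (a b : Q) (h h' : H) :
    elt c a h * elt c b h' = if h = h' then c.σ a b h • elt c (a * b) h else 0 := by
  simp [mul_def, mulMap]

theorem mulMap_assoc (x y z : TwistedSmash c) :
    mulMap c (mulMap c x y) z = mulMap c x (mulMap c y z) := by
  have key : ∀ (a : Q) (h : H) (b : Q) (h' : H) (d : Q) (h'' : H),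
      mulMap c (mulMap c (elt c a h) (elt c b h')) (elt c d h'')
        = mulMap c (elt c a h) (mulMap c (elt c b h') (elt c d h'')) := by
    intro a h b h' d h''
    by_cases h1 : h = h'
    · subst h1
      by_cases h2 : h = h''
      · subst h2
        simp [mulMap, smul_smul, c.σ_assoc, mul_assoc a b d]
      · simp [mulMap, h2]
    · by_cases h2 : h' = h''
      · subst h2
        simp [mulMap, h1]
      · simp [mulMap, h1, h2]
  have step1 : ∀ a h b h', (mulMap c (mulMap c (elt c a h) (elt c b h')))
      = (mulMap c (elt c a h)) ∘ₗ (mulMap c (elt c b h')) := fun a h b h' =>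
    lin_ext fun d h'' => key a h b h' d h''
  have step2 : ∀ a h (z : TwistedSmash c),
      (mulMap c).flip z ∘ₗ mulMap c (elt c a h) = mulMap c (elt c a h) ∘ₗ (mulMap c).flip z :=
    fun a h z => lin_ext fun b h' => LinearMap.congr_fun (step1 a h b h') z
  have step3 : ∀ y z : TwistedSmash c,
      (mulMap c).flip z ∘ₗ (mulMap c).flip y = (mulMap c).flip (mulMap c y z) :=
    fun y z => lin_ext fun a h => LinearMap.congr_fun (step2 a h z) y
  exact LinearMap.congr_fun (step3 y z) x

theorem one_mulMap (x : TwistedSmash c) : mulMap c 1 x = x := by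
  have : mulMap c 1 = LinearMap.id := lin_ext fun a h => by
    simp [one_def, mulMap, LinearMap.sum_apply, c.σ_one_left]
  simp [this]

theorem mulMap_one (x : TwistedSmash c) : mulMap c x 1 = x := by
  have : (mulMap c).flip 1 = LinearMap.id := lin_ext fun a h => by
    simp [one_def, mulMap, c.σ_one_right]
  exact LinearMap.congr_fun this x

instance : Ring (TwistedSmash c) :=
  { (inferInstance : AddCommGroup (TwistedSmash c)) with
    left_distrib := fun x y z => map_add (mulMap c x) y z
    right_distrib := fun x y z => LinearMap.map_add₂ (mulMap c) x y z
    zero_mul := fun x => LinearMap.map_zero₂ (mulMap c) x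
    mul_zero := fun x => map_zero (mulMap c x)
    mul_assoc := mulMap_assoc c
    one_mul := one_mulMap c
    mul_one := mulMap_one c }

instance : Algebra k (TwistedSmash c) :=
  Algebra.ofModule (fun r x y => LinearMap.map_smul₂ (mulMap c) r x y)
    (fun r x y => map_smul (mulMap c x) r y)

/-- `Δ (a # δ_h) = ∑ l, τ l a (l h) • (a # δ_{l⁻¹}) ⊗ (l.a # δ_{l h})` and `ε (a # δ_h) = [h = 1]`. -/
instance : CoalgebraStruct k (TwistedSmash c) where
  comul := lift c fun a h =>
    ∑ l, c.τ l a (l * h) • (elt c a l⁻¹ ⊗ₜ[k] elt c (act l a) (l * h))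
  counit := lift c fun _ h => if h = 1 then 1 else 0

theorem comul_elt (a : Q) (h : H) : Coalgebra.comul (R := k) (elt c a h)
    = ∑ l, c.τ l a (l * h) • (elt c a l⁻¹ ⊗ₜ[k] elt c (act l a) (l * h)) :=
  lift_elt c _ a h

theorem counit_elt (a : Q) (h : H) :
    Coalgebra.counit (R := k) (elt c a h) = if h = 1 then 1 else 0 :=
  lift_elt c _ a h

instance : Coalgebra k (TwistedSmash c) where
  coassoc := lin_ext fun a h => by
    simp only [LinearMap.comp_apply, comul_elt, map_sum, map_smul, LinearMap.rTensor_tmul,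
      LinearMap.lTensor_tmul, TensorProduct.sum_tmul, TensorProduct.tmul_sum,
      LinearEquiv.coe_coe, TensorProduct.smul_tmul', TensorProduct.assoc_tmul,
      Finset.smul_sum, smul_smul]
    rw [Finset.sum_comm]
    refine Finset.sum_congr rfl fun m _ => ?_
    refine Fintype.sum_equiv (Equiv.mulRight m⁻¹) _ _ fun l => ?_
    have e1 : l * m⁻¹ * (m * h) = l * h := by group
    have e2 : (l * m⁻¹)⁻¹ = m * l⁻¹ := by group
    have e3 : act (l * m⁻¹) (act m a) = act l a := by
      rw [← MulAut.mul_apply, ← map_mul]; simp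
    simp only [Equiv.coe_mulRight, e1, e2, e3, ← TensorProduct.smul_tmul', TensorProduct.tmul_smul,
      smul_smul, c.τ_coassoc l m a h]
    rw [mul_comm]
  rTensor_counit_comp_comul := lin_ext fun a h => by
    simp only [LinearMap.comp_apply, comul_elt, map_sum, map_smul, LinearMap.rTensor_tmul,
      counit_elt]
    rw [Finset.sum_eq_single 1]
    · simp [c.τ_one_left]
    · intro l _ hl
      simp [hl]
    · simp
  lTensor_counit_comp_comul := lin_ext fun a h => by
    simp only [LinearMap.comp_apply, comul_elt, map_sum, map_smul, LinearMap.lTensor_tmul,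
      counit_elt]
    rw [Finset.sum_eq_single h⁻¹]
    · simp [c.τ_counit]
    · intro l _ hl
      have : ¬ l * h = 1 := fun e => hl (eq_inv_of_mul_eq_one_left e)
      simp [this]
    · simp

theorem bilin_ext {V : Type*} [AddCommGroup V] [Module k V]
    {f g : TwistedSmash c →ₗ[k] TwistedSmash c →ₗ[k] V}
    (w : ∀ a h b h', f (elt c a h) (elt c b h') = g (elt c a h) (elt c b h')) : f = g :=
  lin_ext fun a h => lin_ext fun b h' => w a h b h'

instance : Bialgebra k (TwistedSmash c) where
  counit_one := by simp [one_def, counit_elt]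
  mul_compr₂_counit := bilin_ext c fun a h b h' => by
    simp only [LinearMap.compr₂_apply, LinearMap.mul_apply', LinearMap.compl₁₂_apply,
      elt_mul_elt, counit_elt]
    by_cases h1 : h = h'
    · subst h1
      by_cases h2 : h = 1
      · subst h2; simp [counit_elt, c.σ_counit]
      · simp [counit_elt, h2]
    · by_cases h2 : h = 1
      · subst h2; simp [h1, Ne.symm h1]
      · simp [h1, h2]
  comul_one := by
    simp only [one_def, map_sum, comul_elt, map_one, c.τ_unit, one_smul,
      Algebra.TensorProduct.one_def, TensorProduct.sum_tmul, TensorProduct.tmul_sum]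
    rw [Finset.sum_comm]
    conv_rhs => rw [Finset.sum_comm]
    refine Fintype.sum_equiv (Equiv.inv H) _ _ fun l => ?_
    exact Fintype.sum_equiv (Equiv.mulLeft l) _ _ fun h => rfl
  mul_compr₂_comul := bilin_ext c fun a h b h' => by
    simp only [LinearMap.compr₂_apply, LinearMap.mul_apply', LinearMap.compl₁₂_apply,
      elt_mul_elt, comul_elt, Finset.sum_mul_sum, smul_mul_smul_comm,
      Algebra.TensorProduct.tmul_mul_tmul, inv_inj]
    have : ∀ l : H, (∑ l', (c.τ l a (l * h) * c.τ l' b (l' * h')) •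
        ((if l = l' then c.σ a b l⁻¹ • elt c (a * b) l⁻¹ else 0) ⊗ₜ[k]
          (if l * h = l' * h' then
            c.σ (act l a) (act l' b) (l * h) • elt c (act l a * act l' b) (l * h) else 0)))
        = if h = h' then (c.τ l a (l * h) * c.τ l b (l * h)) •
          ((c.σ a b l⁻¹ • elt c (a * b) l⁻¹) ⊗ₜ[k]
            (c.σ (act l a) (act l b) (l * h) • elt c (act l a * act l b) (l * h))) else 0 := by
      intro l
      rw [Finset.sum_eq_single l]
      · by_cases h1 : h = h'
        · subst h1; simp
        · simp [h1]
      · intro l' _ hl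
        simp [Ne.symm hl]
      · simp
    simp only [this]
    by_cases h1 : h = h'
    · subst h1
      simp only [if_true, map_smul, comul_elt, Finset.smul_sum, smul_smul,
        ← TensorProduct.smul_tmul', TensorProduct.tmul_smul, c.σ_τ, map_mul]
      refine Finset.sum_congr rfl fun l _ => ?_
      rw [mul_comm (c.σ a b l⁻¹)]
    · simp [h1]

/-- The antipode `S (a # δ_h) = ν a h • (h⁻¹.a⁻¹ # δ_{h⁻¹})`. -/
instance : HopfAlgebra k (TwistedSmash c) where
  antipode := lift c fun a h => c.ν a h • elt c (act h⁻¹ a⁻¹) h⁻¹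
  mul_antipode_rTensor_comul := lin_ext fun a h => by
    simp only [LinearMap.comp_apply, comul_elt, map_sum, map_smul, LinearMap.rTensor_tmul,
      LinearMap.mul'_apply, lift_elt, counit_elt, smul_mul_assoc, elt_mul_elt,
      Algebra.linearMap_apply, inv_inv]
    by_cases h1 : h = 1
    · subst h1
      simp only [mul_one, if_true, map_one, one_def]
      refine Finset.sum_congr rfl fun l _ => ?_
      rw [← map_mul, inv_mul_cancel, map_one, smul_smul, smul_smul, c.ν_left, one_smul]
    · simp [h1]
  mul_antipode_lTensor_comul := lin_ext fun a h => by
    simp only [LinearMap.comp_apply, comul_elt, map_sum, map_smul, LinearMap.lTensor_tmul,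
      LinearMap.mul'_apply, lift_elt, counit_elt, mul_smul_comm, elt_mul_elt,
      Algebra.linearMap_apply]
    by_cases h1 : h = 1
    · subst h1
      simp only [mul_one, if_true, map_one, one_def]
      refine Fintype.sum_equiv (Equiv.inv H) _ _ fun l => ?_
      have e3 : act l⁻¹ (act l a)⁻¹ = a⁻¹ := by
        rw [← map_inv, ← MulAut.mul_apply, ← map_mul]; simp
      rw [e3, mul_inv_cancel, smul_smul, smul_smul, c.ν_right, one_smul]
      rfl
    · simp [h1]

end TwistedSmash

end Hopf

section Smash

variable (k : Type*) [Field k] {Γ H : Type*} [Group Γ] [Group H] (act : H →* MulAut Γ)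

/-- The trivial structure constants. -/
def smashDatum : SmashCocycle k act where
  σ _ _ _ := 1
  τ _ _ _ := 1
  ν _ _ := 1
  σ_one_left _ _ := rfl
  σ_one_right _ _ := rfl
  σ_assoc _ _ _ _ := rfl
  σ_counit _ _ := rfl
  τ_one_left _ _ := rfl
  τ_counit _ _ := rfl
  τ_unit _ _ := rfl
  τ_coassoc _ _ _ _ := rfl
  σ_τ _ _ _ _ := by simp
  ν_left _ _ := by simp
  ν_right _ _ := by simp

theorem smashDatum_σ (a b : Γ) (h : H) : (smashDatum k act).σ a b h = 1 := rfl

/-- The smash coproduct `k[Γ] ⋊ k^H`: it is `k[Γ] ⊗ k^H` as an algebra, with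
`Δ (r # δ_h) = ∑ l, (r # δ_{l⁻¹}) ⊗ (l.r # δ_{l h})`, `ε (r # δ_h) = [h = 1]` and
`S (r # δ_h) = h⁻¹.r⁻¹ # δ_{h⁻¹}`. -/
abbrev SmashCoproduct := TwistedSmash (smashDatum k act)

variable {k} {act} in
/-- The representation of `k[Γ] ⋊ k^H` attached to a representation `π` of `Γ` and a point `y` of
`H`: it sends `r # f` to `f y • π r`, that is, `r # δ_h` to `[h = y] • π r`. -/
def smashRep [Fintype H] [DecidableEq H] {R : Type*} [Ring R] [Algebra k R] (π : Γ →* R) (y : H) :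
    SmashCoproduct k act →ₐ[k] R :=
  AlgHom.ofLinearMap (TwistedSmash.lift _ fun r h => if h = y then π r else 0)
    (by simp [TwistedSmash.one_def])
    (by
      intro u v
      have key : ∀ a h b h', TwistedSmash.lift (smashDatum k act)
            (fun r h => if h = y then π r else 0)
            (TwistedSmash.elt _ a h * TwistedSmash.elt _ b h')
          = (if h = y then π a else 0) * (if h' = y then π b else 0) := by
        intro a h b h'
        rw [TwistedSmash.elt_mul_elt]
        by_cases h1 : h = h'
        · subst h1
          by_cases h2 : h = y <;> simp [h2, smashDatum_σ]
        · by_cases h2 : h = y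
          · subst h2; simp [h1, Ne.symm h1]
          · simp [h1, h2]
      have : (LinearMap.mul k (SmashCoproduct k act)).compr₂
            (TwistedSmash.lift _ fun r h => if h = y then π r else 0)
          = (LinearMap.mul k R).compl₁₂
            (TwistedSmash.lift _ fun r h => if h = y then π r else 0)
            (TwistedSmash.lift _ fun r h => if h = y then π r else 0) :=
        TwistedSmash.bilin_ext _ fun a h b h' => by
          simpa using key a h b h'
      exact LinearMap.congr_fun (LinearMap.congr_fun this u) v)

/-- A quotient datum `(N, Φ)` for `H` acting on `Γ` (with full subgroup `H`). The group of units
of `k^H` is `H → kˣ`. -/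
structure QuotientDatum where
  N : Subgroup Γ
  normal : N.Normal
  stable : ∀ h, ∀ r ∈ N, act h r ∈ N
  Φ : N →* (H → kˣ)
  Φ_mul : ∀ (r : N) (l h : H), Φ r (l * h) = Φ ⟨act l⁻¹ r, stable _ _ r.2⟩ h * Φ r l
  Φ_conj : ∀ (r : N) (s : Γ), Φ r = Φ ⟨s * r * s⁻¹, normal.conj_mem _ r.2 s⟩

attribute [instance] QuotientDatum.normal

variable {k}

/-- The action on `Γ ⧸ N` induced by the action on `Γ`, for an `H`-stable normal subgroup `N`. -/
def quotientAct (N : Subgroup Γ) [N.Normal] (stable : ∀ h, ∀ r ∈ N, act h r ∈ N) :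
    H →* MulAut (Γ ⧸ N) where
  toFun h :=
    { toFun := QuotientGroup.map N N (act h).toMonoidHom (stable h)
      invFun := QuotientGroup.map N N (act h⁻¹).toMonoidHom (stable h⁻¹)
      left_inv := fun x => by
        induction x using QuotientGroup.induction_on with
        | H r => simp
      right_inv := fun x => by
        induction x using QuotientGroup.induction_on with
        | H r => simp
      map_mul' := map_mul _ }
  map_one' := by
    ext x
    induction x using QuotientGroup.induction_on with
    | H r => simp
  map_mul' g h := by
    ext x
    induction x using QuotientGroup.induction_on with
    | H r => simp

@[simp]
theorem quotientAct_mk (N : Subgroup Γ) [N.Normal] (stable : ∀ h, ∀ r ∈ N, act h r ∈ N)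
    (h : H) (r : Γ) : quotientAct act N stable h (r : Γ ⧸ N) = (act h r : Γ) := rfl

/-- A section `j` of the projection `Γ → Γ ⧸ N` with `j 1 = 1`. -/
structure NormalizedSection (N : Subgroup Γ) [N.Normal] where
  j : Γ ⧸ N → Γ
  mk_j : ∀ a, ((j a : Γ) : Γ ⧸ N) = a
  j_one : j 1 = 1

theorem NormalizedSection.nonempty (N : Subgroup Γ) [N.Normal] : Nonempty (NormalizedSection N) :=
  by
  classical
  refine ⟨⟨fun a => if a = 1 then 1 else a.out, fun a => ?_, by simp⟩⟩
  by_cases h : a = 1 <;> simp [h]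

namespace QuotientDatum

variable {act} (D : QuotientDatum k act) (s : NormalizedSection D.N)

/-- `Φ`, extended by `1` outside `N`; only used in proofs. -/
def ext (r : Γ) : H → kˣ := by
  classical exact if hr : r ∈ D.N then D.Φ ⟨r, hr⟩ else 1

theorem Φ_eq (r : Γ) (hr : r ∈ D.N) : D.Φ ⟨r, hr⟩ = D.ext r := by
  simp [ext, hr]

theorem ext_mul {r t : Γ} (hr : r ∈ D.N) (ht : t ∈ D.N) :
    D.ext (r * t) = D.ext r * D.ext t := by
  rw [← D.Φ_eq r hr, ← D.Φ_eq t ht, ← D.Φ_eq (r * t) (mul_mem hr ht), ← map_mul]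
  rfl

theorem ext_one : D.ext 1 = 1 := by
  rw [← D.Φ_eq 1 (one_mem _)]
  exact map_one D.Φ

theorem ext_conj {r : Γ} (hr : r ∈ D.N) (t : Γ) : D.ext (t * r * t⁻¹) = D.ext r := by
  rw [← D.Φ_eq r hr, ← D.Φ_eq _ (D.normal.conj_mem _ hr t), D.Φ_conj ⟨r, hr⟩ t]

theorem ext_swap {r t : Γ} (h : r * t ∈ D.N) : D.ext (t * r) = D.ext (r * t) := by
  rw [← D.ext_conj h t]
  congr 1
  group

theorem ext_shift {r : Γ} (hr : r ∈ D.N) (l h : H) :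
    D.ext (act l r) (l * h) * D.ext r l⁻¹ = D.ext r h := by
  have e := fun h => D.Φ_mul ⟨act l r, D.stable _ _ hr⟩ l h
  have e1 : act l⁻¹ (act l r) = r := by rw [← MulAut.mul_apply, ← map_mul]; simp
  simp only [e1, D.Φ_eq] at e
  have e2 : ∀ x, D.ext x (1 : H) = 1 := by
    intro x
    by_cases hx : x ∈ D.N
    · have := D.Φ_mul ⟨x, hx⟩ 1 1
      simp only [D.Φ_eq, mul_one, inv_one, map_one, MulAut.one_apply] at this
      simpa using this
    · simp [ext, hx]
  have e3 := e l⁻¹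
  rw [mul_inv_cancel, e2] at e3
  rw [e h, mul_assoc, mul_comm (D.ext (act l r) l), ← e3, mul_one]

theorem ext_at_one (x : Γ) : D.ext x (1 : H) = 1 := by
  by_cases hx : x ∈ D.N
  · have := D.ext_shift hx 1 1
    simpa using this
  · simp [ext, hx]

theorem mem_σ (a b : Γ ⧸ D.N) : s.j a * s.j b * (s.j (a * b))⁻¹ ∈ D.N := by
  rw [← QuotientGroup.eq_one_iff]
  simp [s.mk_j]

theorem mem_τ (l : H) (a : Γ ⧸ D.N) :
    act l (s.j a) * (s.j (quotientAct act D.N D.stable l a))⁻¹ ∈ D.N := by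
  rw [← QuotientGroup.eq_one_iff, QuotientGroup.mk_mul, QuotientGroup.mk_inv, s.mk_j,
    ← quotientAct_mk act D.N D.stable, s.mk_j, mul_inv_cancel]

theorem mem_ν (a : Γ ⧸ D.N) (h : H) :
    (s.j (quotientAct act D.N D.stable h⁻¹ a⁻¹))⁻¹ * act h⁻¹ (s.j a)⁻¹ ∈ D.N := by
  rw [← QuotientGroup.eq_one_iff, QuotientGroup.mk_mul, QuotientGroup.mk_inv, s.mk_j,
    ← quotientAct_mk act D.N D.stable, QuotientGroup.mk_inv, s.mk_j, inv_mul_cancel]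

/-- The structure constants of `k[Γ/N] ⋊_Φ k^H`, computed with the section `j`:
* `(a # δ_h) (b # δ_h') = a b # δ_h δ_h' Φ(j(a) j(b) j(ab)⁻¹)`,
* `Δ (a # δ_h) = ∑ l, (a # δ_{l⁻¹}) ⊗ (l.a # δ_{l h} Φ(l.j(a) j(l.a)⁻¹))`,
* `S (a # δ_h) = h⁻¹.a⁻¹ # Φ(j(h⁻¹.a⁻¹)⁻¹ h⁻¹.j(a)⁻¹) δ_{h⁻¹}`. -/
def cocycle : SmashCocycle k (quotientAct act D.N D.stable) where
  σ a b h := D.Φ ⟨s.j a * s.j b * (s.j (a * b))⁻¹, D.mem_σ s a b⟩ h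
  τ l a h :=
    D.Φ ⟨act l (s.j a) * (s.j (quotientAct act D.N D.stable l a))⁻¹, D.mem_τ s l a⟩ h
  ν a h := D.Φ ⟨(s.j (quotientAct act D.N D.stable h⁻¹ a⁻¹))⁻¹ * act h⁻¹ (s.j a)⁻¹,
    D.mem_ν s a h⟩ h⁻¹
  σ_one_left a h := by simp [D.Φ_eq, s.j_one, D.ext_one]
  σ_one_right a h := by simp [D.Φ_eq, s.j_one, D.ext_one]
  σ_assoc a b c h := by
    simp only [D.Φ_eq, ← Units.val_mul, ← Pi.mul_apply]
    have e : ∀ A B C X Y Z : Γ, A * B * X⁻¹ * (X * C * Z⁻¹)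
        = A * (B * C * Y⁻¹) * A⁻¹ * (A * Y * Z⁻¹) := by intros; group
    rw [← D.ext_mul (D.mem_σ s _ _) (D.mem_σ s _ _), ← D.ext_conj (D.mem_σ s b c) (s.j a),
      ← D.ext_mul (D.normal.conj_mem _ (D.mem_σ s b c) _) (D.mem_σ s _ _), mul_assoc a b c,
      ← e]
  σ_counit a b := by simp [D.Φ_eq, D.ext_at_one]
  τ_one_left a h := by simp [D.Φ_eq, D.ext_one]
  τ_counit l a := by simp [D.Φ_eq, D.ext_at_one]
  τ_unit l h := by simp [D.Φ_eq, s.j_one, D.ext_one]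
  τ_coassoc l m a h := by
    simp only [D.Φ_eq, ← Units.val_mul]
    congr 1
    have e3 : quotientAct act D.N D.stable (l * m⁻¹) (quotientAct act D.N D.stable m a)
        = quotientAct act D.N D.stable l a := by
      rw [← MulAut.mul_apply, ← map_mul]; simp
    have e4 : act (l * m⁻¹) (act m (s.j a)) = act l (s.j a) := by
      rw [← MulAut.mul_apply, ← map_mul]; simp
    have e1 := D.ext_shift (D.mem_τ s m a) (l * m⁻¹) (m * h)
    have e2 : (l * m⁻¹)⁻¹ = m * l⁻¹ := by group
    have e5 : l * m⁻¹ * (m * h) = l * h := by group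
    have e6 := D.mem_τ s (l * m⁻¹) (quotientAct act D.N D.stable m a)
    have e7 := D.ext_mul (D.stable (l * m⁻¹) _ (D.mem_τ s m a)) e6
    rw [e2, e5] at e1
    have e8 : act (l * m⁻¹) (act m (s.j a) * (s.j (quotientAct act D.N D.stable m a))⁻¹) *
        (act (l * m⁻¹) (s.j (quotientAct act D.N D.stable m a)) *
          (s.j (quotientAct act D.N D.stable l a))⁻¹)
        = act l (s.j a) * (s.j (quotientAct act D.N D.stable l a))⁻¹ := by
      rw [← mul_assoc, ← map_mul (act (l * m⁻¹)), inv_mul_cancel_right, e4]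
    rw [← e1, mul_right_comm, ← Pi.mul_apply, ← e7, e3, e8]
  σ_τ l a b h := by
    simp only [D.Φ_eq, ← Units.val_mul]
    congr 1
    have e1 := D.ext_shift (D.mem_σ s a b) l h
    have e2 := D.mem_σ s (quotientAct act D.N D.stable l a) (quotientAct act D.N D.stable l b)
    rw [← map_mul] at e2
    have e3 := D.normal.conj_mem _ (D.mem_τ s l b) (s.j (quotientAct act D.N D.stable l a))
    have m1 := congrFun (D.ext_mul (D.stable l _ (D.mem_σ s a b)) (D.mem_τ s l (a * b))) (l * h)
    have m2 := congrFun (D.ext_mul (D.mem_τ s l a) e3) (l * h)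
    have m3 := congrFun (D.ext_mul (mul_mem (D.mem_τ s l a) e3) e2) (l * h)
    have m4 := congrFun (D.ext_conj (D.mem_τ s l b) (s.j (quotientAct act D.N D.stable l a)))
      (l * h)
    have e : ∀ A B P X Y Z : Γ, A * B * P⁻¹ * (P * Z⁻¹)
        = A * X⁻¹ * (X * (B * Y⁻¹) * X⁻¹) * (X * Y * Z⁻¹) := by intros; group
    rw [map_mul (act l), map_mul (act l), map_inv (act l),
      e _ _ _ (s.j (quotientAct act D.N D.stable l a)) (s.j (quotientAct act D.N D.stable l b)),
      m3, Pi.mul_apply, m2, Pi.mul_apply, m4, Pi.mul_apply, ← map_inv (act l), ← map_mul (act l),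
      ← map_mul (act l)] at m1
    rw [← e1, mul_right_comm, ← m1, ← map_mul (quotientAct act _ _ l)]
    rw [mul_comm (D.ext _ l⁻¹), ← mul_assoc]
  ν_left l a := by
    simp only [D.Φ_eq, ← Units.val_mul, inv_inv]
    have e0 := D.mem_ν s a l⁻¹
    have e2 := D.mem_σ s (quotientAct act D.N D.stable l a⁻¹) (quotientAct act D.N D.stable l a)
    have e1 := D.mem_τ s l a
    rw [← map_mul, inv_mul_cancel, map_one, s.j_one, inv_one, mul_one] at e2
    rw [inv_inv] at e0
    rw [← map_mul (quotientAct act _ _ l), inv_mul_cancel, map_one, s.j_one, inv_one, mul_one,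
      ← D.ext_swap e0, ← D.ext_swap e1, ← Pi.mul_apply, ← Pi.mul_apply,
      ← D.ext_mul ((D.normal.mem_comm_iff).1 e1) ((D.normal.mem_comm_iff).1 e0),
      ← D.ext_mul (mul_mem ((D.normal.mem_comm_iff).1 e1) ((D.normal.mem_comm_iff).1 e0)) e2]
    have : ∀ A B C : Γ, B⁻¹ * A * (A⁻¹ * C⁻¹) * (C * B) = 1 := by intros; group
    rw [map_inv, this, D.ext_one]
    simp
  ν_right l a := by
    simp only [D.Φ_eq, ← Units.val_mul]
    have f1 : quotientAct act D.N D.stable l⁻¹ (quotientAct act D.N D.stable l a) = a := by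
      rw [← MulAut.mul_apply, ← map_mul]; simp
    have e0 := D.mem_ν s (quotientAct act D.N D.stable l a) l
    have e2 := D.mem_σ s a a⁻¹
    have e1 := D.mem_τ s l⁻¹ (quotientAct act D.N D.stable l a)
    rw [f1] at e1
    rw [map_inv (quotientAct act _ _ l⁻¹), f1] at e0 ⊢
    rw [mul_inv_cancel, s.j_one, inv_one, mul_one] at e2
    have f2 : act l (act l⁻¹ (s.j (quotientAct act D.N D.stable l a)))
        = s.j (quotientAct act D.N D.stable l a) := by
      rw [← MulAut.mul_apply, ← map_mul]; simp
    have e5 := inv_mem e1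
    rw [mul_inv_rev, inv_inv] at e5
    have e3 := D.ext_shift e5 l 1
    have e6 : s.j a⁻¹ * s.j a ∈ D.N := (D.normal.mem_comm_iff).1 e2
    have e7 := (D.normal.mem_comm_iff).1 e0
    have e8 : ∀ X Y Z : Γ, X * Y⁻¹ * (Y * Z) = X * Z := by intros; group
    rw [map_mul, map_inv, f2, D.ext_at_one, mul_one] at e3
    rw [mul_inv_cancel, s.j_one, inv_one, mul_one, mul_assoc, ← Pi.mul_apply, ← D.ext_swap e0,
      ← D.ext_swap e2, ← D.ext_mul e7 e6, e8, map_inv (act l⁻¹), D.ext_swap e5, e3, Units.val_one]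
end QuotientDatum

end Smash

section HopfImage

universe w x

/-- A factorization `ρ = φ ∘ p` of an algebra map `ρ : A → R` through a Hopf algebra `L`, with `p`
a surjective Hopf algebra map and `φ` an algebra map. (A bialgebra map between Hopf algebras
commutes with the antipodes.) -/
def IsHopfFactorization {k : Type u} [Field k] {A : Type v} [Ring A] [HopfAlgebra k A]
    {R : Type w} [Ring R] [Algebra k R] (ρ : A →ₐ[k] R)
    {L : Type x} [Ring L] [HopfAlgebra k L] (p : A →ₐc[k] L) (φ : L →ₐ[k] R) : Prop :=
  Function.Surjective p ∧ ∀ a, φ (p a) = ρ a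

/-- `(L, p, φ)` is the Hopf image of `ρ : A → R`: a final object in the category of factorizations
of `ρ`. As the map `q` of a factorization is surjective, every factorization is isomorphic to one
through a Hopf algebra in the universe of `A`. -/
def IsHopfImage {k : Type u} [Field k] {A : Type v} [Ring A] [HopfAlgebra k A]
    {R : Type w} [Ring R] [Algebra k R] (ρ : A →ₐ[k] R)
    {L : Type x} [Ring L] [HopfAlgebra k L] (p : A →ₐc[k] L) (φ : L →ₐ[k] R) : Prop :=
  IsHopfFactorization ρ p φ ∧
    ∀ (L' : Type v) [Ring L'] [HopfAlgebra k L'] (q : A →ₐc[k] L') (ψ : L' →ₐ[k] R),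
      IsHopfFactorization ρ q ψ →
        ∃! f : L' →ₐc[k] L, (∀ a, f (q a) = p a) ∧ ∀ b, φ (f b) = ψ b

end HopfImage

section Gamma

/-- The relators of `Γ_{M,N}`: the `g_i ^ N`, and the commutators of
`g_{i_1} ⋯ g_{i_N}` and `g_{j_1} ⋯ g_{j_N}`. -/
def gammaRels (M N : ℕ) : Set (FreeGroup (ZMod M)) :=
  Set.range (fun i => FreeGroup.of i ^ N) ∪
    Set.range fun x : (Fin N → ZMod M) × (Fin N → ZMod M) =>
      ⁅(List.ofFn fun c => FreeGroup.of (x.1 c)).prod,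
        (List.ofFn fun c => FreeGroup.of (x.2 c)).prod⁆

/-- The group `Γ_{M,N}`. -/
abbrev Gamma (M N : ℕ) := PresentedGroup (gammaRels M N)

/-- The generators `g_i` of `Γ_{M,N}`. -/
def gen {M N : ℕ} (i : ZMod M) : Gamma M N := PresentedGroup.of i

theorem gen_pow {M N : ℕ} (i : ZMod M) : (gen i : Gamma M N) ^ N = 1 :=
  PresentedGroup.one_of_mem (Or.inl ⟨i, rfl⟩)

theorem gen_comm {M N : ℕ} (x y : Fin N → ZMod M) :
    ⁅(List.ofFn fun c => (gen (x c) : Gamma M N)).prod,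
      (List.ofFn fun c => (gen (y c) : Gamma M N)).prod⁆
      = 1 := by
  have := PresentedGroup.one_of_mem (rels := gammaRels M N) (Or.inr ⟨(x, y), rfl⟩)
  simpa [gen, PresentedGroup.of, map_commutatorElement, map_list_prod, List.map_ofFn,
    Function.comp_def] using this

/-- The endomorphism `g_i ↦ g_{i + a}` of `Γ_{M,N}`. -/
def gammaShift (M N : ℕ) (a : ZMod M) : Gamma M N →* Gamma M N :=
  PresentedGroup.toGroup (f := fun i => gen (i + a)) (by
    rintro _ (⟨i, rfl⟩ | ⟨x, rfl⟩)
    · simp [gen_pow]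
    · simpa [map_commutatorElement, map_list_prod, List.map_ofFn, Function.comp_def] using
        gen_comm (fun c => x.1 c + a) (fun c => x.2 c + a))

@[simp]
theorem gammaShift_gen {M N : ℕ} (a i : ZMod M) :
    gammaShift M N a (gen i) = gen (i + a) := PresentedGroup.toGroup.of _

/-- The cyclic action of `ℤ_M = ⟨h⟩` on `Γ_{M,N}`, `h.g_i = g_{i + 1}`. The group `ℤ_M` is written
multiplicatively, with generator `h = Multiplicative.ofAdd 1`. -/
def cyclicAct (M N : ℕ) : Multiplicative (ZMod M) →* MulAut (Gamma M N) where
  toFun a :=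
    { toFun := gammaShift M N a.toAdd
      invFun := gammaShift M N (-a.toAdd)
      left_inv := fun x => DFunLike.congr_fun (PresentedGroup.ext (φ := (gammaShift M N
        (-a.toAdd)).comp (gammaShift M N a.toAdd)) (ψ := MonoidHom.id _) fun i => by
          change gammaShift M N _ (gammaShift M N _ (gen i)) = gen i
          simp) x
      right_inv := fun x => DFunLike.congr_fun (PresentedGroup.ext (φ := (gammaShift M N
        a.toAdd).comp (gammaShift M N (-a.toAdd))) (ψ := MonoidHom.id _) fun i => by
          change gammaShift M N _ (gammaShift M N _ (gen i)) = gen i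
          simp) x
      map_mul' := map_mul _ }
  map_one' := by
    ext x
    exact DFunLike.congr_fun (PresentedGroup.ext (φ := gammaShift M N 0) (ψ := MonoidHom.id _)
      fun i => by
        change gammaShift M N _ (gen i) = gen i
        simp) x
  map_mul' a b := by
    ext x
    exact DFunLike.congr_fun (PresentedGroup.ext (φ := gammaShift M N (a.toAdd + b.toAdd))
      (ψ := (gammaShift M N a.toAdd).comp (gammaShift M N b.toAdd))
      fun i => by
        change gammaShift M N _ (gen i) = gammaShift M N _ (gammaShift M N _ (gen i))
        simp [add_assoc, add_comm a.toAdd]) x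

@[simp]
theorem cyclicAct_gen {M N : ℕ} (a : Multiplicative (ZMod M)) (i : ZMod M) :
    cyclicAct M N a (gen i) = gen (i + a.toAdd) := gammaShift_gen _ _

/-- The product `g_0 g_1` in `Γ_{2,2} = ℤ_2 * ℤ_2`. -/
def rot : Gamma 2 2 := gen 0 * gen 1

theorem gen_mul_self (i : ZMod 2) : (gen i : Gamma 2 2) * gen i = 1 := by
  rw [← sq, gen_pow]

theorem gen_inv (i : ZMod 2) : (gen i : Gamma 2 2)⁻¹ = gen i :=
  inv_eq_of_mul_eq_one_left (gen_mul_self i)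

theorem rot_inv : rot⁻¹ = gen 1 * gen 0 := by
  rw [rot, mul_inv_rev, gen_inv, gen_inv]

theorem rot_conj (s : Gamma 2 2) : s * rot * s⁻¹ = rot ∨ s * rot * s⁻¹ = rot⁻¹ := by
  let K : Subgroup (Gamma 2 2) :=
    { carrier := {s | s * rot * s⁻¹ = rot ∨ s * rot * s⁻¹ = rot⁻¹}
      one_mem' := by simp
      mul_mem' := by
        intro a b ha hb
        have e : a * b * rot * (a * b)⁻¹ = a * (b * rot * b⁻¹) * a⁻¹ := by group
        have e' : a * rot⁻¹ * a⁻¹ = (a * rot * a⁻¹)⁻¹ := by group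
        simp only [Set.mem_ofPred_eq] at ha hb ⊢
        rw [e]
        rcases hb with hb | hb <;> rw [hb]
        · exact ha
        · rw [e']
          rcases ha with ha | ha <;> simp [ha]
      inv_mem' := by
        intro a ha
        simp only [Set.mem_ofPred_eq, inv_inv] at ha ⊢
        rcases ha with ha | ha
        · left
          nth_rw 1 [← ha]
          group
        · right
          have e' : a * rot⁻¹ * a⁻¹ = (a * rot * a⁻¹)⁻¹ := by group
          rw [ha, inv_inv] at e'
          have e : ∀ x : Gamma 2 2, a⁻¹ * (a * x * a⁻¹) * a = x := by intro x; group
          calc a⁻¹ * rot * a = a⁻¹ * (a * rot⁻¹ * a⁻¹) * a := by rw [e']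
            _ = rot⁻¹ := e _ }
  refine PresentedGroup.generated_by _ K (fun j => ?_) s
  change gen j * rot * (gen j)⁻¹ = rot ∨ gen j * rot * (gen j)⁻¹ = rot⁻¹
  right
  rw [rot_inv, gen_inv, rot]
  fin_cases j
  · change gen 0 * (gen 0 * gen 1) * gen 0 = gen 1 * gen 0
    rw [← mul_assoc, gen_mul_self, one_mul]
  · change gen 1 * (gen 0 * gen 1) * gen 1 = gen 1 * gen 0
    rw [mul_assoc, mul_assoc, gen_mul_self, mul_one]

theorem rot_act (a : Multiplicative (ZMod 2)) :
    cyclicAct 2 2 a rot = rot ∨ cyclicAct 2 2 a rot = rot⁻¹ := by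
  rw [rot_inv, rot, map_mul, cyclicAct_gen, cyclicAct_gen]
  obtain ⟨b, rfl⟩ := Multiplicative.ofAdd.surjective a
  fin_cases b
  · left; rfl
  · right; rfl

/-- The subgroup `N_m = ⟨(g_0 g_1)^m⟩` of `Γ_{2,2}`. -/
def rotSubgroup (m : ℕ) : Subgroup (Gamma 2 2) := Subgroup.zpowers (rot ^ m)

theorem rot_conj_zpow (m : ℕ) (s : Gamma 2 2) (n : ℤ) :
    s * (rot ^ m) ^ n * s⁻¹ = (rot ^ m) ^ n ∨ s * (rot ^ m) ^ n * s⁻¹ = (rot ^ m) ^ (-n) := by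
  rw [← conj_zpow, ← conj_pow]
  rcases rot_conj s with h | h <;> simp [h]

theorem rot_act_zpow (m : ℕ) (a : Multiplicative (ZMod 2)) (n : ℤ) :
    cyclicAct 2 2 a ((rot ^ m) ^ n) = (rot ^ m) ^ n ∨
      cyclicAct 2 2 a ((rot ^ m) ^ n) = (rot ^ m) ^ (-n) := by
  rw [map_zpow, map_pow]
  rcases rot_act a with h | h <;> simp [h]

instance rotSubgroup_normal (m : ℕ) : (rotSubgroup m).Normal where
  conj_mem := by
    rintro _ ⟨n, rfl⟩ s
    rcases rot_conj_zpow m s n with h | h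
    · exact ⟨n, h.symm⟩
    · exact ⟨-n, h.symm⟩

theorem rotSubgroup_stable (m : ℕ) (a : Multiplicative (ZMod 2)) :
    ∀ r ∈ rotSubgroup m, cyclicAct 2 2 a r ∈ rotSubgroup m := by
  rintro _ ⟨n, rfl⟩
  rcases rot_act_zpow m a n with h | h
  · exact ⟨n, h.symm⟩
  · exact ⟨-n, h.symm⟩

/-- `Γ_{2,2}` maps to the infinite dihedral group. -/
def gammaToDihedral : Gamma 2 2 →* DihedralGroup 0 :=
  PresentedGroup.toGroup (f := fun i : ZMod 2 => DihedralGroup.sr (i.val : ZMod 0)) (by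
    rintro _ (⟨i, rfl⟩ | ⟨x, rfl⟩)
    · simp [sq]
    · simp [List.ofFn_succ, commutatorElement_def]
      rw [DihedralGroup.one_def]
      congr 1
      ring)

theorem rot_pow_injective {m : ℕ} (hm : 0 < m) :
    Function.Injective fun n : ℤ => (rot ^ m) ^ n := by
  have h : ∀ n : ℤ, gammaToDihedral ((rot ^ m) ^ n) = DihedralGroup.r ((m : ZMod 0) * (Int.cast n : ZMod 0)) := by
    intro n
    have : gammaToDihedral rot = DihedralGroup.r 1 := by
      rw [rot, map_mul]
      change gammaToDihedral (PresentedGroup.of 0) * gammaToDihedral (PresentedGroup.of 1) = _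
      rw [gammaToDihedral, PresentedGroup.toGroup.of, PresentedGroup.toGroup.of]
      rfl
    rw [map_zpow, map_pow, this, ← zpow_natCast, ← zpow_mul, DihedralGroup.r_one_zpow, Int.cast_mul,
      Int.cast_natCast]
  intro n n' e
  have e' := congrArg gammaToDihedral e
  simp only [h] at e'
  have : (m * n : ℤ) = m * n' := by
    have e2 : (Int.cast (m * n : ℤ) : ZMod 0) = Int.cast (m * n' : ℤ) := by
      rw [Int.cast_mul, Int.cast_mul]
      exact DihedralGroup.r.inj e'
    exact Int.modEq_zero_iff.1 ((ZMod.intCast_eq_intCast_iff _ _ 0).1 e2)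
  exact mul_left_cancel₀ (by exact_mod_cast hm.ne') this

/-- `N_m` is infinite cyclic for `m ≥ 1`. -/
def rotEquiv {m : ℕ} (hm : 0 < m) : Multiplicative ℤ ≃* rotSubgroup m :=
  MulEquiv.ofBijective
    (zpowersHom (rotSubgroup m) ⟨rot ^ m, Subgroup.mem_zpowers _⟩)
    ⟨fun a b e => Multiplicative.toAdd.injective
      (rot_pow_injective hm (by simpa [Subtype.ext_iff] using e)), by
      rintro ⟨_, n, rfl⟩
      exact ⟨Multiplicative.ofAdd n, Subtype.ext (by simp)⟩⟩

variable (k : Type*) [Field k]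

/-- The character `χ` of `ℤ_2 = ⟨h⟩` with `χ(h) = -1`, as an element of `(k^{ℤ_2})ˣ`. -/
def chi : Multiplicative (ZMod 2) → kˣ := fun y => if y = 1 then 1 else -1

/-- For `m ≥ 1`, the morphism `Φ_m : N_m → (k^{ℤ_2})ˣ` with `Φ_m ((g_0 g_1)^m) = χ`. -/
def rotPhi {m : ℕ} (hm : 0 < m) : rotSubgroup m →* (Multiplicative (ZMod 2) → kˣ) :=
  (zpowersHom _ (chi k)).comp (rotEquiv hm).symm.toMonoidHom

theorem rotPhi_zpow {m : ℕ} (hm : 0 < m) (n : ℤ) (h : (rot ^ m) ^ n ∈ rotSubgroup m) :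
    rotPhi k hm ⟨(rot ^ m) ^ n, h⟩ = chi k ^ n := by
  have : (⟨(rot ^ m) ^ n, h⟩ : rotSubgroup m) = rotEquiv hm (Multiplicative.ofAdd n) :=
    Subtype.ext (by
      change (rot ^ m) ^ n = ((zpowersHom (rotSubgroup m) ⟨rot ^ m, Subgroup.mem_zpowers _⟩)
        (Multiplicative.ofAdd n) : rotSubgroup m)
      simp)
  rw [this]
  simp [rotPhi]

theorem chi_inv : (chi k)⁻¹ = chi k := by
  funext y
  by_cases h : y = 1 <;> simp [chi, h]

theorem chi_mul (y z : Multiplicative (ZMod 2)) : chi k (y * z) = chi k y * chi k z := by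
  obtain ⟨b, rfl⟩ := Multiplicative.ofAdd.surjective y
  obtain ⟨d, rfl⟩ := Multiplicative.ofAdd.surjective z
  have h1 : (Multiplicative.ofAdd (1 : ZMod 2)) ≠ 1 := by decide
  have h2 : (Multiplicative.ofAdd (1 : ZMod 2)) * Multiplicative.ofAdd 1 = 1 := by decide
  fin_cases b <;> fin_cases d
  · change chi k (1 * 1) = chi k 1 * chi k 1
    simp [chi]
  · change chi k (1 * Multiplicative.ofAdd 1) = chi k 1 * chi k (Multiplicative.ofAdd 1)
    simp [chi]
  · change chi k (Multiplicative.ofAdd 1 * 1) = chi k (Multiplicative.ofAdd 1) * chi k 1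
    simp [chi]
  · change chi k (Multiplicative.ofAdd 1 * Multiplicative.ofAdd 1)
      = chi k (Multiplicative.ofAdd 1) * chi k (Multiplicative.ofAdd 1)
    rw [h2]
    simp [chi, h1]

theorem chi_zpow_neg (n : ℤ) : chi k ^ (-n) = chi k ^ n := by
  rw [zpow_neg, ← inv_zpow, chi_inv]

/-- The quotient datum `(N_m, Φ_m)`. -/
def rotDatum {m : ℕ} (hm : 0 < m) : QuotientDatum k (cyclicAct 2 2) where
  N := rotSubgroup m
  normal := rotSubgroup_normal m
  stable := rotSubgroup_stable m
  Φ := rotPhi k hm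
  Φ_mul := by
    rintro ⟨r, hr⟩ l h
    obtain ⟨n, rfl⟩ := Subgroup.mem_zpowers_iff.1 hr
    have e : rotPhi k hm ⟨cyclicAct 2 2 l⁻¹ ((rot ^ m) ^ n), rotSubgroup_stable m _ _ ⟨n, rfl⟩⟩
        = chi k ^ n := by
      rcases rot_act_zpow m l⁻¹ n with h | h
      · simp only [h, rotPhi_zpow]
      · simp only [h, rotPhi_zpow, chi_zpow_neg]
    simp only [e, rotPhi_zpow, Pi.pow_apply, chi_mul, mul_zpow]
    rw [mul_comm]
  Φ_conj := by
    rintro ⟨r, hr⟩ s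
    obtain ⟨n, rfl⟩ := Subgroup.mem_zpowers_iff.1 hr
    rcases rot_conj_zpow m s n with h | h
    · simp only [h, rotPhi_zpow]
    · simp only [h, rotPhi_zpow, chi_zpow_neg]

/-- The Hopf algebra `A(m) = k[Γ_{2,2} / N_m] ⋊ k^{ℤ_2}`. -/
abbrev HopfA (m : ℕ) :=
  SmashCoproduct k (quotientAct (cyclicAct 2 2) (rotSubgroup m) (rotSubgroup_stable m))

/-- The Hopf algebra `B(m) = k[Γ_{2,2} / N_m] ⋊_{Φ_m} k^{ℤ_2}`, for `m ≥ 1`, written with the help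
of a section `s` of the projection `Γ_{2,2} → Γ_{2,2} / N_m` with `s 1 = 1` (up to isomorphism it
does not depend on `s`). -/
abbrev HopfB {m : ℕ} (hm : 0 < m) (s : NormalizedSection (rotSubgroup m)) :=
  TwistedSmash ((rotDatum k hm).cocycle s)

end Gamma

section Representation

variable {k : Type*} [Field k]

/-- The matrix `θ_{ic} = Q_{i-1,c} Q_{i,c-1} / (Q_{ic} Q_{i-1,c-1})` attached to `Q`, with indices
modulo `2`. -/
def theta (Q : ZMod 2 → ZMod 2 → kˣ) (i c : ZMod 2) : kˣ :=
  Q (i - 1) c * Q i (c - 1) / (Q i c * Q (i - 1) (c - 1))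

/-- The parameter matrix `Q` with rows `(1, 1)` and `(1, q)`. -/
def paramQ (q : kˣ) (i c : ZMod 2) : kˣ := if i = 1 ∧ c = 1 then q else 1

/-- The matrix of the endomorphism `ε_c ↦ θ_{ic} ε_{c-1}` of `k^2`. -/
def genMatrix (q : kˣ) (i : ZMod 2) : Matrix (ZMod 2) (ZMod 2) k :=
  Matrix.of fun d c => if d = c - 1 then (theta (paramQ q) i c : k) else 0

theorem genMatrix_mul (q : kˣ) (i j : ZMod 2) : genMatrix q i * genMatrix q j =
    Matrix.diagonal fun c => (theta (paramQ q) i (c - 1) : k) * theta (paramQ q) j c := by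
  ext d c
  have h : ∀ c : ZMod 2, c - 1 - 1 = c := by decide
  simp only [genMatrix, Matrix.mul_apply, Matrix.of_apply, Matrix.diagonal_apply]
  rw [Finset.sum_eq_single (c - 1)]
  · by_cases e : d = c <;> simp [h, e]
  · intro x _ hx
    simp [hx]
  · simp

theorem genMatrix_sq (q : kˣ) (i : ZMod 2) : genMatrix q i * genMatrix q i = 1 := by
  rw [genMatrix_mul, ← Matrix.diagonal_one]
  congr 1
  funext c
  have h : ∀ c : ZMod 2, c - 1 - 1 = c := by decide
  rw [← Units.val_mul, theta, theta, h, mul_comm (paramQ q i c), mul_comm (paramQ q i (c - 1)),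
    div_mul_div_cancel, div_self', Units.val_one]

/-- The matrix `genMatrix q i` as an invertible matrix. -/
def genUnit (q : kˣ) (i : ZMod 2) : (Matrix (ZMod 2) (ZMod 2) k)ˣ :=
  ⟨genMatrix q i, genMatrix q i, genMatrix_sq q i, genMatrix_sq q i⟩

/-- The representation of `Γ_{2,2}` on `k^2` with `g_i : ε_c ↦ θ_{ic} ε_{c-1}`. -/
def gammaRep (q : kˣ) : Gamma 2 2 →* (Matrix (ZMod 2) (ZMod 2) k)ˣ :=
  PresentedGroup.toGroup (f := genUnit q) (by
    rintro _ (⟨i, rfl⟩ | ⟨x, rfl⟩)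
    · ext1
      simp [sq, genUnit, genMatrix_sq]
    · dsimp only
      rw [map_commutatorElement, commutatorElement_eq_one_iff_mul_comm]
      simp only [List.ofFn_succ, map_mul, FreeGroup.lift_apply_of, List.ofFn_zero, List.prod_cons, List.prod_nil, mul_one]
      apply Units.ext
      simp only [Units.val_mul, genUnit, genMatrix_mul, Matrix.diagonal_mul_diagonal]
      congr 1
      funext c
      exact mul_comm _ _)

/-- The representation `ρ_q : k[Γ_{2,2}] ⋊ k^{ℤ_2} → M_2(k) = End(k^2)`, with
`ρ_q (g_i # 1) (ε_c) = θ_{ic} ε_{c-1}` and `ρ_q (1 # f) = f(h) id`, where `ℤ_2 = ⟨h⟩`. -/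
def rho (q : kˣ) : SmashCoproduct k (cyclicAct 2 2) →ₐ[k] Matrix (ZMod 2) (ZMod 2) k :=
  smashRep ((Units.coeHom _).comp (gammaRep q)) (Multiplicative.ofAdd 1)

end Representation

end

noncomputable section

/-! ### Normal form in the infinite dihedral group and its finite dihedral quotients. -/

section DihedralGamma

/-! Write Γ for `Gamma 2 2`, H for ℤ₂ with generator h, and M for the order of q⁴ (`orderOf`, hence
0 if infinite). Γ is infinite dihedral: every element is a rotation `rot ^ n` or a reflection `rot ^
n * gen 0`. Since `rot` acts as diag(q², q⁻²), the first row of the matrix of an element has a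
single nonzero entry, q^(2n) in column 0 or q^(2n+1) in column 1. The column and the square of the
entry determine the element modulo N_M (`mem_rotSubgroup_of_rowEntry`).

No factorization of ρ_q can identify more than this. Functionals that factor through a coalgebra map
p are closed under convolution, so if ρ_q factors through p, all convolution products of its matrix
coefficients do too. As h shifts matrix indices by one, these products include the functionals r #
δ_1 ↦ a^(2n+2) and r # δ_h ↦ a^(2n+3), each zero on the other component, where a is a first-row
entry of r. By a Vandermonde argument they separate basis elements with distinct a². Hence a
factorization p₀ through a twisted smash coproduct over Γ/N_M has the largest possible kernel
(`IsHopfFactorization.map_eq_zero`), which makes it the Hopf image.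

Such a p₀ exists because `rot ^ M` acts by the scalar q^(2M) = ±1, the square of q^(2M) being 1.
With Φ trivial for the sign +1 and Φ = Φ_M for −1, the group N_M acts through the values Φ(·)(h),
and the map r # δ_y ↦ r̄ # Φ(r j(r̄)⁻¹) δ_y is a surjective Hopf map through which ρ_q factors
(`QuotientDatum.exists_factorization`). The two signs give A(M) and B(M). The listed cases follow
from M = o(q) / gcd(o(q), 4). -/

theorem gen_conj_zpow (n : ℤ) : gen 0 * rot ^ n = rot ^ (-n) * (gen 0 : Gamma 2 2) := by
  have h : gen 0 * rot * (gen 0)⁻¹ = rot⁻¹ := by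
    rw [rot_inv, gen_inv, rot, ← mul_assoc, gen_mul_self, one_mul]
  have h' := congrArg (· ^ n) h
  simp only [conj_zpow] at h'
  rw [zpow_neg, ← inv_zpow, ← h', inv_mul_cancel_right]

theorem gen_one_eq : (gen 1 : Gamma 2 2) = rot ^ (-1 : ℤ) * gen 0 := by
  rw [zpow_neg_one, rot_inv, mul_assoc, gen_mul_self, mul_one]

/-- Every element of `Γ_{2,2}` is a rotation `rot ^ n` or a reflection `rot ^ n * g_0`. -/
theorem gamma_normal_form (r : Gamma 2 2) : ∃ n : ℤ, r = rot ^ n ∨ r = rot ^ n * gen 0 := by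
  let K : Subgroup (Gamma 2 2) :=
    { carrier := {r | ∃ n : ℤ, r = rot ^ n ∨ r = rot ^ n * gen 0}
      one_mem' := ⟨0, by simp⟩
      mul_mem' := by
        rintro a b ⟨n, rfl | rfl⟩ ⟨m, rfl | rfl⟩
        · exact ⟨n + m, Or.inl (zpow_add _ _ _).symm⟩
        · exact ⟨n + m, Or.inr (by rw [zpow_add, mul_assoc])⟩
        · exact ⟨n - m, Or.inr (by
            rw [mul_assoc, gen_conj_zpow, ← mul_assoc, ← zpow_add, sub_eq_add_neg])⟩
        · exact ⟨n - m, Or.inl (by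
            rw [mul_assoc, ← mul_assoc (gen 0), gen_conj_zpow, mul_assoc, gen_mul_self, mul_one,
              ← zpow_add, sub_eq_add_neg])⟩
      inv_mem' := by
        rintro a ⟨n, rfl | rfl⟩
        · exact ⟨-n, Or.inl (zpow_neg _ _).symm⟩
        · exact ⟨n, Or.inr (by rw [mul_inv_rev, gen_inv, ← zpow_neg, gen_conj_zpow, neg_neg])⟩ }
  refine PresentedGroup.generated_by _ K (fun j => ?_) r
  change ∃ n : ℤ, gen j = rot ^ n ∨ gen j = rot ^ n * gen 0
  fin_cases j
  · exact ⟨0, Or.inr (by simp; rfl)⟩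
  · exact ⟨-1, Or.inr gen_one_eq⟩

/-- The projection of `Γ_{2,2}` onto the dihedral group of order `2 m`. -/
def gammaToDihedralMod (m : ℕ) : Gamma 2 2 →* DihedralGroup m :=
  PresentedGroup.toGroup (f := fun i : ZMod 2 => DihedralGroup.sr (i.val : ZMod m)) (by
    rintro _ (⟨i, rfl⟩ | ⟨x, rfl⟩)
    · simp [sq]
    -- A product of two reflections is a rotation, and rotations commute.
    · simp [List.ofFn_succ, commutatorElement_def]
      rw [DihedralGroup.one_def]
      congr 1
      ring)

theorem gammaToDihedralMod_gen_zero (m : ℕ) :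
    gammaToDihedralMod m (gen 0) = DihedralGroup.sr 0 := by
  rw [gammaToDihedralMod, gen, PresentedGroup.toGroup.of]
  simp

theorem gammaToDihedralMod_rot_zpow (m : ℕ) (n : ℤ) :
    gammaToDihedralMod m (rot ^ n) = DihedralGroup.r (n : ZMod m) := by
  have : gammaToDihedralMod m rot = DihedralGroup.r 1 := by
    rw [rot, map_mul, gammaToDihedralMod_gen_zero, gammaToDihedralMod, gen,
      PresentedGroup.toGroup.of, DihedralGroup.sr_mul_sr]
    simp [ZMod.val_one]
  rw [map_zpow, this, DihedralGroup.r_one_zpow]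

theorem gammaToDihedralMod_surjective (m : ℕ) : Function.Surjective (gammaToDihedralMod m) := by
  rintro (i | i)
  · obtain ⟨n, rfl⟩ := ZMod.intCast_surjective i
    exact ⟨rot ^ n, gammaToDihedralMod_rot_zpow m n⟩
  · obtain ⟨n, rfl⟩ := ZMod.intCast_surjective i
    exact ⟨rot ^ (-n) * gen 0, by
      rw [map_mul, gammaToDihedralMod_rot_zpow, gammaToDihedralMod_gen_zero,
        DihedralGroup.r_mul_sr]
      simp⟩

theorem rot_zpow_mem_rotSubgroup {m : ℕ} {n : ℤ} (h : (m : ℤ) ∣ n) : rot ^ n ∈ rotSubgroup m := by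
  obtain ⟨c, rfl⟩ := h
  exact ⟨c, by simp [zpow_mul]⟩

/-- By the normal form only rotations can die, since reflections map to reflections. This yields the
index 2m of N_m, from which the dimension of the Hopf image is read off. -/
theorem ker_gammaToDihedralMod (m : ℕ) : (gammaToDihedralMod m).ker = rotSubgroup m := by
  ext r
  rw [MonoidHom.mem_ker]
  constructor
  · intro h
    obtain ⟨n, rfl | rfl⟩ := gamma_normal_form r
    · rw [gammaToDihedralMod_rot_zpow, DihedralGroup.one_def, DihedralGroup.r.injEq] at h
      exact rot_zpow_mem_rotSubgroup ((ZMod.intCast_zmod_eq_zero_iff_dvd _ _).1 h)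
    · rw [map_mul, gammaToDihedralMod_rot_zpow, gammaToDihedralMod_gen_zero,
        DihedralGroup.r_mul_sr, DihedralGroup.one_def] at h
      cases h
  · rintro ⟨c, rfl⟩
    change gammaToDihedralMod m ((rot ^ m) ^ c) = 1
    rw [← zpow_natCast, ← zpow_mul, gammaToDihedralMod_rot_zpow, DihedralGroup.one_def]
    simp

theorem index_rotSubgroup (m : ℕ) : (rotSubgroup m).index = 2 * m := by
  rw [← ker_gammaToDihedralMod, Subgroup.index_ker,
    MonoidHom.range_eq_top.2 (gammaToDihedralMod_surjective m), Subgroup.card_top,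
    DihedralGroup.nat_card]

end DihedralGamma

/-! ### The matrices of the representation of Γ and their first rows. -/

section GammaRep

variable {k : Type*} [Field k] (q : kˣ)

theorem gammaRep_gen (i : ZMod 2) : gammaRep q (gen i) = genUnit q i :=
  PresentedGroup.toGroup.of _

theorem theta_zero_zero : theta (paramQ q) 0 0 = q⁻¹ := by simp [theta, paramQ]
theorem theta_zero_one : theta (paramQ q) 0 1 = q := by simp [theta, paramQ]
theorem theta_one_zero : theta (paramQ q) 1 0 = q := by simp [theta, paramQ]
theorem theta_one_one : theta (paramQ q) 1 1 = q⁻¹ := by simp [theta, paramQ]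

/-- This symmetry of θ is what makes the action of h on Γ a shift of matrix indices in
`gammaRep_act`. -/
theorem theta_add_one (i c : ZMod 2) :
    theta (paramQ q) (i + 1) (c + 1) = theta (paramQ q) i c := by
  have e : (1 : ZMod 2) + 1 = 0 := by decide
  fin_cases i <;> fin_cases c
  · change theta (paramQ q) (0 + 1) (0 + 1) = theta (paramQ q) 0 0
    simp [theta_zero_zero, theta_one_one]
  · change theta (paramQ q) (0 + 1) (1 + 1) = theta (paramQ q) 0 1
    simp [e, theta_zero_one, theta_one_zero]
  · change theta (paramQ q) (1 + 1) (0 + 1) = theta (paramQ q) 1 0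
    simp [e, theta_zero_one, theta_one_zero]
  · change theta (paramQ q) (1 + 1) (1 + 1) = theta (paramQ q) 1 1
    simp [e, theta_zero_zero, theta_one_one]

theorem gammaRep_rot : ((gammaRep q rot : (Matrix (ZMod 2) (ZMod 2) k)ˣ) :
    Matrix (ZMod 2) (ZMod 2) k) =
      Matrix.diagonal fun c => ((if c = 0 then q ^ 2 else q ^ (-2 : ℤ) : kˣ) : k) := by
  rw [rot, map_mul, gammaRep_gen, gammaRep_gen, Units.val_mul, genUnit, genUnit]
  dsimp only
  rw [genMatrix_mul]
  congr 1
  funext c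
  fin_cases c
  · change (theta (paramQ q) 0 1 : k) * theta (paramQ q) 1 0 = ((q ^ 2 : kˣ) : k)
    simp [theta_zero_one, theta_one_zero, sq]
  · change (theta (paramQ q) 0 0 : k) * theta (paramQ q) 1 1 = ((q ^ (-2 : ℤ) : kˣ) : k)
    rw [theta_zero_zero, theta_one_one, ← Units.val_mul]
    congr 1
    group

theorem gammaRep_rot_zpow (n : ℤ) : ((gammaRep q (rot ^ n) : (Matrix (ZMod 2) (ZMod 2) k)ˣ) :
    Matrix (ZMod 2) (ZMod 2) k) =
      Matrix.diagonal fun c => ((if c = 0 then q ^ (2 * n) else q ^ (-(2 * n)) : kˣ) : k) := by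
  -- Diagonal invertible matrices form the image of a group morphism, so integer powers can be taken
  -- entrywise.
  let F : (ZMod 2 → kˣ) →* (Matrix (ZMod 2) (ZMod 2) k)ˣ :=
    (Units.map (Matrix.diagonalRingHom (ZMod 2) k).toMonoidHom).comp
      MulEquiv.piUnits.symm.toMonoidHom
  have hF : ∀ f, (F f : Matrix (ZMod 2) (ZMod 2) k) = Matrix.diagonal fun c => (f c : k) :=
    fun _ => rfl
  have h : gammaRep q rot = F fun c => if c = 0 then q ^ 2 else q ^ (-2 : ℤ) := by
    apply Units.ext
    rw [hF, gammaRep_rot]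
  rw [map_zpow, h, ← map_zpow, hF]
  congr 1
  funext c
  by_cases hc : c = 0
  · simp only [Pi.pow_apply, hc, if_true, zpow_mul]
    norm_cast
  · simp only [Pi.pow_apply, hc, if_false, ← zpow_mul]
    norm_num

/-- The entries of the first row of the matrices of the representation of `Γ_{2,2}`. -/
def rowEntry (σ : ZMod 2) (r : Gamma 2 2) : k :=
  (gammaRep q r : Matrix (ZMod 2) (ZMod 2) k) 0 σ

theorem rowEntry_rot_zpow (σ : ZMod 2) (n : ℤ) :
    rowEntry q σ (rot ^ n) = if σ = 0 then ((q ^ (2 * n) : kˣ) : k) else 0 := by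
  rw [rowEntry, gammaRep_rot_zpow, Matrix.diagonal_apply]
  simp [eq_comm]

theorem rowEntry_rot_zpow_mul_gen (σ : ZMod 2) (n : ℤ) :
    rowEntry q σ (rot ^ n * gen 0) = if σ = 1 then ((q ^ (2 * n + 1) : kˣ) : k) else 0 := by
  rw [rowEntry, map_mul, Units.val_mul, gammaRep_rot_zpow, gammaRep_gen, Matrix.diagonal_mul,
    genUnit]
  simp only [genMatrix, Matrix.of_apply, if_true]
  have h : (0 = σ - 1) ↔ σ = 1 := by rw [eq_comm, sub_eq_zero]
  by_cases hσ : σ = 1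
  · simp only [hσ, sub_self, if_true, theta_zero_one, ← Units.val_mul]
    rw [zpow_add, zpow_one]
  · simp [h, hσ]

theorem exists_rowEntry_ne_zero (r : Gamma 2 2) : ∃ σ, rowEntry q σ r ≠ 0 := by
  obtain ⟨n, rfl | rfl⟩ := gamma_normal_form r
  · exact ⟨0, by rw [rowEntry_rot_zpow, if_pos rfl]; exact Units.ne_zero _⟩
  · exact ⟨1, by rw [rowEntry_rot_zpow_mul_gen, if_pos rfl]; exact Units.ne_zero _⟩

/-- The squares of the row entries determine an element modulo `N_m`, `m` the order of `q ^ 4`. -/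
theorem mem_rotSubgroup_of_rowEntry {σ : ZMod 2} {r t : Gamma 2 2} (h0 : rowEntry q σ r ≠ 0)
    (h : rowEntry q σ t ^ 2 = rowEntry q σ r ^ 2) :
    t * r⁻¹ ∈ rotSubgroup (orderOf (q ^ 4)) := by
  have ht0 : rowEntry q σ t ≠ 0 := fun e => h0 (by simpa [e] using h.symm)
  -- The offset e is 0 for two rotations and 1 for two reflections. Equality of squares reads q^(4(n
  -- − n')) = 1 in either case.
  have key : ∀ n n' e : ℤ, ((q ^ (2 * n + e) : kˣ) : k) ^ 2 = ((q ^ (2 * n' + e) : kˣ) : k) ^ 2 →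
      rot ^ (n - n') ∈ rotSubgroup (orderOf (q ^ 4)) := by
    intro n n' e h
    apply rot_zpow_mem_rotSubgroup
    rw [orderOf_dvd_iff_zpow_eq_one]
    rw [← Units.val_pow_eq_pow_val, ← Units.val_pow_eq_pow_val, Units.val_inj, ← zpow_natCast,
      ← zpow_natCast, ← zpow_mul, ← zpow_mul, ← mul_inv_eq_one, ← zpow_neg, ← zpow_add] at h
    rw [← zpow_natCast, ← zpow_mul, ← h]
    congr 1
    push_cast
    ring
  obtain ⟨n, rfl | rfl⟩ := gamma_normal_form t <;> obtain ⟨n', rfl | rfl⟩ := gamma_normal_form r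
  · simp only [rowEntry_rot_zpow] at h h0
    by_cases hσ : σ = 0
    · rw [← zpow_neg, ← zpow_add, ← sub_eq_add_neg]
      exact key n n' 0 (by simpa [hσ] using h)
    · simp [hσ] at h0
  -- A rotation and a reflection never have nonzero first-row entries in the same column.
  · simp only [rowEntry_rot_zpow, rowEntry_rot_zpow_mul_gen] at ht0 h0
    by_cases hσ : σ = 0
    · simp [hσ] at h0
    · simp [hσ] at ht0
  · simp only [rowEntry_rot_zpow, rowEntry_rot_zpow_mul_gen] at ht0 h0
    by_cases hσ : σ = 0
    · simp [hσ] at ht0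
    · simp [hσ] at h0
  · simp only [rowEntry_rot_zpow_mul_gen] at h h0
    by_cases hσ : σ = 1
    · rw [mul_inv_rev, mul_assoc, mul_inv_cancel_left, ← zpow_neg, ← zpow_add, ← sub_eq_add_neg]
      exact key n n' 1 (by simpa [hσ] using h)
    · simp [hσ] at h0

/-- Both sides are group morphisms in r, the right one being the representation reindexed by c ↦ c +
1, so it suffices to compare them on generators, where θ is invariant under the simultaneous shift.
-/
theorem gammaRep_act (r : Gamma 2 2) (d c : ZMod 2) :
    (gammaRep q (cyclicAct 2 2 (Multiplicative.ofAdd 1) r) : Matrix (ZMod 2) (ZMod 2) k) d c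
      = (gammaRep q r : Matrix (ZMod 2) (ZMod 2) k) (d + 1) (c + 1) := by
  let F : (Matrix (ZMod 2) (ZMod 2) k)ˣ →* (Matrix (ZMod 2) (ZMod 2) k)ˣ :=
    Units.map (Matrix.reindexAlgEquiv k k (Equiv.addRight (1 : ZMod 2)).symm : _ ≃ₐ[k] _)
  have h : (gammaRep q).comp (cyclicAct 2 2 (Multiplicative.ofAdd 1)).toMonoidHom
      = F.comp (gammaRep q) := by
    refine PresentedGroup.ext fun i => ?_
    change gammaRep q (cyclicAct 2 2 _ (gen i)) = F (gammaRep q (gen i))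
    rw [cyclicAct_gen, gammaRep_gen, gammaRep_gen]
    ext d c
    change genMatrix q (i + 1) d c = genMatrix q i (d + 1) (c + 1)
    have e : (d = c - 1) ↔ (d + 1 = c + 1 - 1) := by
      constructor <;> intro h
      · rw [h]; ring
      · rw [add_sub_cancel_right] at h; rw [← h]; ring
    have hc : c + 1 + 1 = c := by rw [add_assoc, show (1 : ZMod 2) + 1 = 0 from rfl, add_zero]
    have := theta_add_one q i (c + 1)
    rw [hc] at this
    simp only [genMatrix, Matrix.of_apply, ← e, this]
  exact congrArg (fun u : (Matrix (ZMod 2) (ZMod 2) k)ˣ => (u : Matrix (ZMod 2) (ZMod 2) k) d c)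
    (DFunLike.congr_fun h r)

end GammaRep
end

noncomputable section

/-! ### Convolution of functionals and the Vandermonde argument. -/

section Convolution

variable {k : Type*} [Field k]

/-- The convolution product of two functionals on a coalgebra. -/
def convFun {C : Type*} [AddCommGroup C] [Module k C] [Coalgebra k C] (f g : C →ₗ[k] k) :
    C →ₗ[k] k :=
  LinearMap.mul' k k ∘ₗ TensorProduct.map f g ∘ₗ Coalgebra.comul

/-- The functional `f` factors through the linear map `p`. -/
def FactorsThrough {C D : Type*} [AddCommGroup C] [Module k C] [AddCommGroup D] [Module k D]
    (p : C →ₗ[k] D) (f : C →ₗ[k] k) : Prop :=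
  ∃ g : D →ₗ[k] k, ∀ x, f x = g (p x)

/-- Because p commutes with comultiplication, the convolution of the induced functionals on the
target pulls back to the convolution on the source. -/
theorem FactorsThrough.convFun {C D : Type*} [AddCommGroup C] [Module k C] [Coalgebra k C]
    [AddCommGroup D] [Module k D] [Coalgebra k D] {p : C →ₗc[k] D} {f g : C →ₗ[k] k}
    (hf : FactorsThrough p.toLinearMap f) (hg : FactorsThrough p.toLinearMap g) :
    FactorsThrough p.toLinearMap (convFun f g) := by
  obtain ⟨f', hf⟩ := hf
  obtain ⟨g', hg⟩ := hg
  obtain rfl : f = f' ∘ₗ p.toLinearMap := LinearMap.ext hf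
  obtain rfl : g = g' ∘ₗ p.toLinearMap := LinearMap.ext hg
  refine ⟨_root_.convFun f' g', fun x => ?_⟩
  have h := LinearMap.congr_fun p.map_comp_comul x
  simp only [LinearMap.comp_apply] at h
  simp only [_root_.convFun, LinearMap.comp_apply]
  rw [← h, TensorProduct.map_comp, LinearMap.comp_apply]

theorem convFun_elt {Q H : Type*} [Group Q] [Group H] [Fintype H] [DecidableEq H]
    {act : H →* MulAut Q} (c : SmashCocycle k act) (f g : TwistedSmash c →ₗ[k] k) (a : Q) (h : H) :
    convFun f g (TwistedSmash.elt c a h) = ∑ l, c.τ l a (l * h) *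
      (f (TwistedSmash.elt c a l⁻¹) * g (TwistedSmash.elt c (act l a) (l * h))) := by
  simp [convFun, TwistedSmash.comul_elt]

/-- A finitely supported function is determined by its sums against the powers of a function. -/
theorem Finsupp.eq_zero_of_sum_mul_pow {ι : Type*} (f : ι →₀ k) (v : ι → k) (e : ℕ)
    (H : ∀ n : ℕ, (f.sum fun b x => x * v b ^ (2 * n + e)) = 0) {a : ι} (ha : v a ≠ 0)
    (inj : ∀ b, v b ^ 2 = v a ^ 2 → b = a) : f a = 0 := by
  classical
  -- By linearity the power sums extend to sums of v^e · P(v²) for every polynomial P.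
  have key : ∀ P : Polynomial k, (f.sum fun b x => x * v b ^ e * P.eval (v b ^ 2)) = 0 := by
    intro P
    induction P using Polynomial.induction_on' with
    | add P P' hP hP' =>
      simp only [Finsupp.sum] at hP hP' ⊢
      simp [mul_add, Finset.sum_add_distrib, hP, hP']
    | monomial n r =>
      have := congrArg (r * ·) (H n)
      simp only [Finsupp.sum, mul_zero, Finset.mul_sum] at this ⊢
      rw [← this]
      refine Finset.sum_congr rfl fun b _ => ?_
      rw [Polynomial.eval_monomial, pow_add, pow_mul]
      ring
  by_contra hfa
  -- Interpolation: this polynomial in v² vanishes at every support point other than a and, by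
  -- `inj`, not at a.
  have := key (∏ b ∈ f.support.erase a, (Polynomial.X - Polynomial.C (v b ^ 2)))
  rw [Finsupp.sum, Finset.sum_eq_single a] at this
  · refine mul_ne_zero (mul_ne_zero hfa (pow_ne_zero _ ha)) ?_ this
    rw [Polynomial.eval_prod, Finset.prod_ne_zero_iff]
    intro b hb
    have hb' := (Finset.mem_erase.1 hb).1
    simpa [sub_eq_zero] using fun h => hb' (inj b h.symm)
  · intro b hb hba
    rw [Polynomial.eval_prod, Finset.prod_eq_zero (i := b)]
    · simp
    · exact Finset.mem_erase.2 ⟨hba, hb⟩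
    · simp
  · intro h
    exact absurd (Finsupp.mem_support_iff.2 hfa) h

end Convolution

theorem smashRep_elt {k Γ H : Type*} [Field k] [Group Γ] [Group H] [Fintype H] [DecidableEq H]
    {act : H →* MulAut Γ} {R : Type*} [Ring R] [Algebra k R] (π : Γ →* R) (y : H) (r : Γ) (h : H) :
    smashRep (k := k) (act := act) π y (TwistedSmash.elt _ r h) = if h = y then π r else 0 := by
  change TwistedSmash.lift (smashDatum k act) (fun r h => if h = y then π r else 0)
    (TwistedSmash.elt _ r h) = _
  rw [TwistedSmash.lift_elt]

/-! ### Descent of bialgebra maps along a surjection. -/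

section HopfImageLift

/-- A bialgebra map vanishing on the kernel of a surjective bialgebra map descends. -/
theorem BialgHom.exists_lift {k A B C : Type*} [Field k] [Ring A] [Bialgebra k A] [Ring B]
    [Bialgebra k B] [Ring C] [Bialgebra k C] (p : A →ₐc[k] B) (hp : Function.Surjective p)
    (g : A →ₐc[k] C) (h : ∀ x, p x = 0 → g x = 0) : ∃ f : B →ₐc[k] C, ∀ a, f (p a) = g a := by
  have key : ∀ a, g (Function.surjInv hp (p a)) = g a := fun a => by
    rw [← sub_eq_zero, ← map_sub]
    exact h _ (by rw [map_sub, Function.surjInv_eq hp, sub_self])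
  let f : B →ₐ[k] C :=
    { toFun := fun b => g (Function.surjInv hp b)
      map_one' := by rw [← map_one p, key, map_one]
      map_zero' := by rw [← map_zero p, key, map_zero]
      map_mul' := fun b b' => by
        obtain ⟨a, rfl⟩ := hp b
        obtain ⟨a', rfl⟩ := hp b'
        rw [← map_mul, key, key, key, map_mul]
      map_add' := fun b b' => by
        obtain ⟨a, rfl⟩ := hp b
        obtain ⟨a', rfl⟩ := hp b'
        rw [← map_add, key, key, key, map_add]
      commutes' := fun t => by
        rw [← AlgHomClass.commutes p, key, AlgHomClass.commutes] }
  have hf : ∀ a, f (p a) = g a := key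
  have e : f.comp (p : A →ₐ[k] B) = (g : A →ₐ[k] C) := AlgHom.ext hf
  -- Compatibility with the counit and comultiplication is checked after composing with the
  -- surjection p.
  refine ⟨BialgHom.ofAlgHom f ?_ ?_, hf⟩
  · refine (AlgHom.cancel_right (f := (p : A →ₐ[k] B)) hp).1 ?_
    rw [AlgHom.comp_assoc, e, BialgHom.counitAlgHom_comp, BialgHom.counitAlgHom_comp]
  · refine (AlgHom.cancel_right (f := (p : A →ₐ[k] B)) hp).1 ?_
    rw [AlgHom.comp_assoc, AlgHom.comp_assoc, e, ← BialgHom.map_comp_comulAlgHom,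
      ← BialgHom.map_comp_comulAlgHom, ← e, ← AlgHom.comp_assoc, Algebra.TensorProduct.map_comp]

end HopfImageLift

/-! ### Power functionals obtained from matrix coefficients, and maximality of the kernel. -/

section Functionals

variable {k : Type*} [Field k] (q : kˣ)

open TwistedSmash

/-- The matrix coefficients of `ρ_q`. -/
def rhoCoeff (d c : ZMod 2) : SmashCoproduct k (cyclicAct 2 2) →ₗ[k] k :=
  Matrix.entryLinearMap k k d c ∘ₗ (rho q).toLinearMap

theorem rho_elt (r : Gamma 2 2) (y : Multiplicative (ZMod 2)) :
    rho q (elt _ r y) = if y = Multiplicative.ofAdd 1 then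
      (gammaRep q r : Matrix (ZMod 2) (ZMod 2) k) else 0 := by
  rw [rho, smashRep_elt]
  rfl

theorem smashDatum_τ {Γ H : Type*} [Group Γ] [Group H] (act : H →* MulAut Γ) (l : H) (r : Γ)
    (h : H) : (smashDatum k act).τ l r h = 1 := rfl

theorem rhoCoeff_elt (d c : ZMod 2) (r : Gamma 2 2) (y : Multiplicative (ZMod 2)) :
    rhoCoeff q d c (elt _ r y) = if y = Multiplicative.ofAdd 1 then
      (gammaRep q r : Matrix (ZMod 2) (ZMod 2) k) d c else 0 := by
  change rho q (elt _ r y) d c = _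
  rw [rho_elt]
  split_ifs <;> rfl

/-- The functional `r # δ_y ↦ [y = 1] (rowEntry q σ r) ^ (2 n + 2)`. -/
def evenFun (σ : ZMod 2) : ℕ → (SmashCoproduct k (cyclicAct 2 2) →ₗ[k] k)
  | 0 => convFun (rhoCoeff q 0 σ) (rhoCoeff q 1 (σ + 1))
  | n + 1 => convFun (evenFun σ n) (evenFun σ 0)

/-- The functional `r # δ_y ↦ [y = h] (rowEntry q σ r) ^ (2 n + 3)`. -/
def oddFun (σ : ZMod 2) (n : ℕ) : SmashCoproduct k (cyclicAct 2 2) →ₗ[k] k :=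
  convFun (evenFun q σ n) (rhoCoeff q 0 σ)

/-- If f lives on the component δ_1, only l = 1 survives in the coproduct; convolving by f then
multiplies values pointwise and keeps the component on which g lives. -/
theorem convFun_elt_of_support {f : SmashCoproduct k (cyclicAct 2 2) →ₗ[k] k}
    (hf : ∀ r y, y ≠ 1 → f (elt _ r y) = 0) (g : SmashCoproduct k (cyclicAct 2 2) →ₗ[k] k)
    (r : Gamma 2 2) (y : Multiplicative (ZMod 2)) :
    convFun f g (elt _ r y) = f (elt _ r 1) * g (elt _ r y) := by
  rw [convFun_elt, Finset.sum_eq_single 1]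
  · simp [smashDatum_τ]
  · intro l _ hl
    rw [hf r l⁻¹ (inv_ne_one.2 hl)]
    simp
  · simp

/-- ρ_q sees only δ_h, so for n = 0 only l = h contributes, and only when y = 1. By the index shift,
the coefficient (1, σ + 1) at h.r is the coefficient (0, σ) at r, which produces a square. -/
theorem evenFun_elt (σ : ZMod 2) (n : ℕ) (r : Gamma 2 2) (y : Multiplicative (ZMod 2)) :
    evenFun q σ n (elt _ r y) = if y = 1 then rowEntry q σ r ^ (2 * n + 2) else 0 := by
  have h0 : ∀ r y, evenFun q σ 0 (elt _ r y) = if y = 1 then rowEntry q σ r ^ 2 else 0 := by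
    intro r y
    rw [evenFun, convFun_elt, Finset.sum_eq_single (Multiplicative.ofAdd 1)]
    · have e : (1 : ZMod 2) + 1 = 0 := by decide
      simp only [rhoCoeff_elt, gammaRep_act, e, add_assoc, add_zero, mul_eq_left]
      rw [if_pos (by decide)]
      split_ifs
      · simp [smashDatum_τ, rowEntry, sq]
      · simp
    · intro l _ hl
      rw [rhoCoeff_elt, if_neg]
      · simp
      · intro e
        exact hl (by rw [← inv_inv l, e]; decide)
    · simp
  induction n generalizing r y with
  | zero => exact h0 r y
  | succ n ih =>
    rw [evenFun, convFun_elt_of_support _ (evenFun q σ 0), ih, h0, if_pos rfl]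
    · split_ifs
      · rw [← pow_add]
        congr 1
      · simp
    · intro r y hy
      rw [ih, if_neg hy]

theorem oddFun_elt (σ : ZMod 2) (n : ℕ) (r : Gamma 2 2) (y : Multiplicative (ZMod 2)) :
    oddFun q σ n (elt _ r y)
      = if y = Multiplicative.ofAdd 1 then rowEntry q σ r ^ (2 * n + 3) else 0 := by
  rw [oddFun, convFun_elt_of_support, evenFun_elt, rhoCoeff_elt, if_pos rfl]
  · split_ifs
    · rw [pow_succ _ (2 * n + 2)]
      rfl
    · simp
  · intro r y hy
    rw [evenFun_elt, if_neg hy]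

variable {q}
variable {L : Type*} [Ring L] [HopfAlgebra k L] {p : SmashCoproduct k (cyclicAct 2 2) →ₐc[k] L}
  {φ : L →ₐ[k] Matrix (ZMod 2) (ZMod 2) k}

theorem factorsThrough_rhoCoeff (h : IsHopfFactorization (rho q) p φ) (d c : ZMod 2) :
    FactorsThrough p.toCoalgHom.toLinearMap (rhoCoeff q d c) :=
  ⟨Matrix.entryLinearMap k k d c ∘ₗ φ.toLinearMap, fun x =>
    (congrArg (fun M : Matrix (ZMod 2) (ZMod 2) k => M d c) (h.2 x)).symm⟩

theorem factorsThrough_evenFun (h : IsHopfFactorization (rho q) p φ) (σ : ZMod 2) (n : ℕ) :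
    FactorsThrough p.toCoalgHom.toLinearMap (evenFun q σ n) := by
  have h0 : FactorsThrough p.toCoalgHom.toLinearMap (evenFun q σ 0) := by
    rw [evenFun]
    exact (factorsThrough_rhoCoeff h 0 σ).convFun (factorsThrough_rhoCoeff h 1 (σ + 1))
  induction n with
  | zero => exact h0
  | succ n ih =>
    rw [evenFun]
    exact ih.convFun h0

theorem factorsThrough_oddFun (h : IsHopfFactorization (rho q) p φ) (σ : ZMod 2) (n : ℕ) :
    FactorsThrough p.toCoalgHom.toLinearMap (oddFun q σ n) :=
  (factorsThrough_evenFun h σ n).convFun (factorsThrough_rhoCoeff h 0 σ)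

/-- A factorization of `ρ_q` through a twisted smash coproduct on whose basis the even and odd
functionals separate points has the largest possible kernel. -/
theorem IsHopfFactorization.map_eq_zero {Q : Type*} [Group Q]
    {act : Multiplicative (ZMod 2) →* MulAut Q} {c : SmashCocycle k act}
    {p₀ : SmashCoproduct k (cyclicAct 2 2) →ₐc[k] TwistedSmash c}
    {φ₀ : TwistedSmash c →ₐ[k] Matrix (ZMod 2) (ZMod 2) k}
    (h₀ : IsHopfFactorization (rho q) p₀ φ₀) (j : Q → Gamma 2 2)
    (hj : ∀ a y, p₀ (elt _ (j a) y) = elt c a y)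
    (hinj : ∀ σ a b, rowEntry q σ (j a) ≠ 0 →
      rowEntry q σ (j b) ^ 2 = rowEntry q σ (j a) ^ 2 → b = a)
    (h : IsHopfFactorization (rho q) p φ) {x : SmashCoproduct k (cyclicAct 2 2)} (hx : p x = 0) :
    p₀ x = 0 := by
  -- A functional factoring through p kills x. If it also factors through p₀, its value on x is a
  -- sum over the coordinates of p₀ x, weighted by its values at the lifts j(b).
  have expand : ∀ T : SmashCoproduct k (cyclicAct 2 2) →ₗ[k] k,
      FactorsThrough p.toCoalgHom.toLinearMap T → FactorsThrough p₀.toCoalgHom.toLinearMap T →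
      (((basis c).repr (p₀ x)).sum fun b t => t * T (elt _ (j b.1) b.2)) = 0 := by
    rintro T ⟨T', hT'⟩ ⟨T₀, hT₀⟩
    have e1 : T₀ (p₀ x) = 0 := by
      have e2 : T x = T₀ (p₀ x) := hT₀ x
      have e3 : T x = T' (p x) := hT' x
      rw [← e2, e3, hx, map_zero]
    rw [← e1]
    conv_rhs => rw [← (basis c).linearCombination_repr (p₀ x)]
    rw [Finsupp.linearCombination_apply, map_finsuppSum]
    refine Finsupp.sum_congr fun b _ => ?_
    rw [map_smul, smul_eq_mul]
    congr 1
    have e4 : T (elt _ (j b.1) b.2) = T₀ (p₀ (elt _ (j b.1) b.2)) := hT₀ _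
    rw [e4, hj]
    rfl
  refine (basis c).repr.map_eq_zero_iff.1 (Finsupp.ext fun ⟨a, y⟩ => ?_)
  obtain ⟨σ, hσ⟩ := exists_rowEntry_ne_zero q (j a)
  -- The row entry is truncated to the component y. With exponents at least 2, as below, its powers
  -- vanish off that component, as the even and odd functionals do.
  have sep : ∀ e : ℕ, e ≠ 0 → (∀ n : ℕ, (((basis c).repr (p₀ x)).sum fun b t =>
      t * (if b.2 = y then rowEntry q σ (j b.1) else 0) ^ (2 * n + e)) = 0) →
      (basis c).repr (p₀ x) (a, y) = 0 := by
    intro e he H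
    refine Finsupp.eq_zero_of_sum_mul_pow _
      (fun b => if b.2 = y then rowEntry q σ (j b.1) else 0) e H (by simpa using hσ) ?_
    rintro ⟨b, z⟩ hb
    by_cases hz : z = y
    · subst hz
      exact Prod.ext (hinj σ a b hσ (by simpa using hb)) rfl
    · simp only [hz, if_true, if_false] at hb
      exact absurd (by simpa using hb.symm) hσ
  by_cases hy : y = 1
  · subst hy
    refine sep 2 (by simp) fun n => ?_
    refine Eq.trans (Finsupp.sum_congr fun b _ => ?_)
      (expand (evenFun q σ n) (factorsThrough_evenFun h σ n) (factorsThrough_evenFun h₀ σ n))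
    rw [evenFun_elt]
    split_ifs <;> simp
  · have hy' : y = Multiplicative.ofAdd 1 := by
      clear sep
      revert y
      decide
    subst hy'
    refine sep 3 (by simp) fun n => ?_
    refine Eq.trans (Finsupp.sum_congr fun b _ => ?_)
      (expand (oddFun q σ n) (factorsThrough_oddFun h σ n) (factorsThrough_oddFun h₀ σ n))
    rw [oddFun_elt]
    split_ifs <;> simp

end Functionals

end

noncomputable section

/-! ### The projection onto the twisted quotient. -/

namespace QuotientDatum

open TwistedSmash

variable {k Γ H : Type*} [Field k] [Group Γ] [Group H] {act : H →* MulAut Γ}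
  (D : QuotientDatum k act) (s : NormalizedSection D.N)

theorem cocycle_σ (a b : Γ ⧸ D.N) (h : H) :
    (D.cocycle s).σ a b h = D.ext (s.j a * s.j b * (s.j (a * b))⁻¹) h := by
  rw [← D.Φ_eq _ (D.mem_σ s a b)]
  rfl

theorem cocycle_τ (l : H) (a : Γ ⧸ D.N) (h : H) : (D.cocycle s).τ l a h
    = D.ext (act l (s.j a) * (s.j (quotientAct act D.N D.stable l a))⁻¹) h := by
  rw [← D.Φ_eq _ (D.mem_τ s l a)]
  rfl

theorem mul_section_inv_mem (r : Γ) : r * (s.j (r : Γ ⧸ D.N))⁻¹ ∈ D.N := by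
  rw [← QuotientGroup.eq_one_iff]
  simp [s.mk_j]

/-- Decompose r = (r j(r̄)⁻¹) j(r̄), likewise t, and move j(r̄) past the N-part of t; conjugation
invariance of Φ removes the conjugation. This gives multiplicativity of `quotientLin`. -/
theorem ext_section_mul (r t : Γ) (h : H) :
    D.ext (r * t * (s.j (r * t : Γ))⁻¹) h = D.ext (r * (s.j r)⁻¹) h * D.ext (t * (s.j t)⁻¹) h
      * D.ext (s.j r * s.j t * (s.j ((r : Γ ⧸ D.N) * t))⁻¹) h := by
  have e : r * t * (s.j (r * t : Γ))⁻¹ = r * (s.j r)⁻¹ * (s.j r * (t * (s.j t)⁻¹) * (s.j r)⁻¹) *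
      (s.j r * s.j t * (s.j ((r : Γ ⧸ D.N) * t))⁻¹) := by
    rw [← QuotientGroup.mk_mul]
    group
  have hr := D.mul_section_inv_mem s r
  have ht := D.mul_section_inv_mem s t
  have ht' := D.normal.conj_mem _ ht (s.j r)
  rw [e, D.ext_mul (mul_mem hr ht') (D.mem_σ s _ _), D.ext_mul hr ht', D.ext_conj ht]
  rfl

/-- The same decomposition, now with the twisted equivariance of Φ (`ext_shift`). It matches the
coefficients in the compatibility of `quotientLin` with Δ. -/
theorem ext_section_act (l : H) (r : Γ) (h : H) :
    D.ext (r * (s.j r)⁻¹) h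
        * D.ext (act l (s.j r) * (s.j (quotientAct act D.N D.stable l r))⁻¹) (l * h)
      = D.ext (r * (s.j r)⁻¹) l⁻¹ * D.ext (act l r * (s.j (act l r : Γ))⁻¹) (l * h) := by
  have e : act l r * (s.j (act l r : Γ))⁻¹ = act l (r * (s.j r)⁻¹) *
      (act l (s.j r) * (s.j (quotientAct act D.N D.stable l r))⁻¹) := by
    rw [quotientAct_mk, map_mul, map_inv]
    group
  have hr := D.mul_section_inv_mem s r
  rw [e, D.ext_mul (D.stable l _ hr) (D.mem_τ s l _), ← D.ext_shift hr l h, Pi.mul_apply]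
  rw [← mul_assoc, mul_comm (D.ext _ l⁻¹)]

variable [Fintype H] [DecidableEq H]

/-- The linear map `r # δ_h ↦ r̄ # Φ(r j(r̄)⁻¹) δ_h`. -/
def quotientLin : SmashCoproduct k act →ₗ[k] TwistedSmash (D.cocycle s) :=
  lift _ fun r h => (D.ext (r * (s.j r)⁻¹) h : k) • elt _ (r : Γ ⧸ D.N) h

theorem quotientLin_elt (r : Γ) (h : H) : D.quotientLin s (elt _ r h)
    = (D.ext (r * (s.j r)⁻¹) h : k) • elt _ (r : Γ ⧸ D.N) h :=
  lift_elt _ _ _ _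

theorem quotientLin_section (a : Γ ⧸ D.N) (h : H) :
    D.quotientLin s (elt _ (s.j a) h) = elt _ a h := by
  rw [quotientLin_elt, s.mk_j, mul_inv_cancel, D.ext_one]
  simp

theorem quotientLin_surjective : Function.Surjective (D.quotientLin s) := by
  have h : D.quotientLin s ∘ₗ lift (D.cocycle s) (fun a h => elt _ (s.j a) h) = LinearMap.id :=
    lin_ext fun a h => by
      rw [LinearMap.comp_apply, lift_elt, quotientLin_section, LinearMap.id_apply]
  exact fun x => ⟨_, LinearMap.congr_fun h x⟩

theorem quotientLin_mul (x y : SmashCoproduct k act) :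
    D.quotientLin s (x * y) = D.quotientLin s x * D.quotientLin s y := by
  have : (LinearMap.mul k (SmashCoproduct k act)).compr₂ (D.quotientLin s)
      = (LinearMap.mul k (TwistedSmash (D.cocycle s))).compl₁₂ (D.quotientLin s)
        (D.quotientLin s) :=
    bilin_ext _ fun r h t h' => by
      simp only [LinearMap.compr₂_apply, LinearMap.mul_apply', LinearMap.compl₁₂_apply,
        quotientLin_elt, smul_mul_smul_comm, elt_mul_elt]
      by_cases hh : h = h'
      · subst hh
        rw [if_pos rfl, if_pos rfl, smashDatum_σ, one_smul, quotientLin_elt, smul_smul, cocycle_σ,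
          ext_section_mul, Units.val_mul, Units.val_mul]
        rfl
      · simp [hh]
  exact LinearMap.congr_fun (LinearMap.congr_fun this x) y

theorem quotientLin_one : D.quotientLin s 1 = 1 := by
  rw [TwistedSmash.one_def, TwistedSmash.one_def, map_sum]
  refine Finset.sum_congr rfl fun h _ => ?_
  rw [quotientLin_elt, QuotientGroup.mk_one, s.j_one, inv_one, mul_one, D.ext_one]
  simp

/-- The projection `k[Γ] ⋊ k^H → k[Γ/N] ⋊_Φ k^H`. -/
def quotientHom : SmashCoproduct k act →ₐc[k] TwistedSmash (D.cocycle s) :=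
  BialgHom.ofAlgHom
    (AlgHom.ofLinearMap (D.quotientLin s) (D.quotientLin_one s) (D.quotientLin_mul s))
    (AlgHom.toLinearMap_injective <| lin_ext fun r h => by
      change Coalgebra.counit (R := k) (D.quotientLin s (elt _ r h))
        = Coalgebra.counit (R := k) (elt _ r h)
      rw [quotientLin_elt, map_smul, counit_elt, counit_elt]
      by_cases hh : h = 1
      · subst hh
        simp [D.ext_at_one]
      · simp [hh])
    (AlgHom.toLinearMap_injective <| lin_ext fun r h => by
      change TensorProduct.map (D.quotientLin s) (D.quotientLin s)
          (Coalgebra.comul (R := k) (elt _ r h))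
        = Coalgebra.comul (R := k) (D.quotientLin s (elt _ r h))
      rw [quotientLin_elt, map_smul, comul_elt, comul_elt, map_sum, Finset.smul_sum]
      refine Finset.sum_congr rfl fun l _ => ?_
      rw [smashDatum_τ, one_smul, TensorProduct.map_tmul, quotientLin_elt, quotientLin_elt,
        TensorProduct.smul_tmul_smul, smul_smul, cocycle_τ, ← Units.val_mul, ← Units.val_mul,
        ext_section_act]
      rfl)

theorem quotientHom_section (a : Γ ⧸ D.N) (h : H) :
    D.quotientHom s (elt _ (s.j a) h) = elt _ a h :=
  D.quotientLin_section s a h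

/-- The representation attached to `π : Γ → R` and `y ∈ H` factors through `k[Γ/N] ⋊_Φ k^H` as
soon as `N` acts through the scalars `Φ(r)(y)`. -/
theorem exists_factorization {R : Type*} [Ring R] [Algebra k R] (π : Γ →* R) (y : H)
    (hπ : ∀ r : D.N, π r = algebraMap k R (D.Φ r y)) :
    ∃ φ : TwistedSmash (D.cocycle s) →ₐ[k] R,
      IsHopfFactorization (smashRep π y) (D.quotientHom s) φ := by
  -- Evaluating π at the representative j(a) is harmless: any other lift differs by an element of N,
  -- on which π is the scalar Φ(·)(y) built into the projection.
  let φ : TwistedSmash (D.cocycle s) →ₗ[k] R := lift _ fun a h => if h = y then π (s.j a) else 0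
  have hφ : ∀ x, φ (D.quotientLin s x) = smashRep π y x := by
    intro x
    refine LinearMap.congr_fun (f := φ ∘ₗ D.quotientLin s) (g := (smashRep π y).toLinearMap)
      (lin_ext fun r h => ?_) x
    rw [LinearMap.comp_apply, quotientLin_elt, map_smul, lift_elt, AlgHom.toLinearMap_apply,
      smashRep_elt]
    by_cases hh : h = y
    · subst hh
      have hr := D.mul_section_inv_mem s r
      have e := hπ ⟨_, hr⟩
      rw [D.Φ_eq] at e
      rw [if_pos rfl, if_pos rfl, Algebra.smul_def, ← e, ← map_mul, inv_mul_cancel_right]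
    · simp [hh]
  refine ⟨AlgHom.ofLinearMap φ ?_ ?_, D.quotientLin_surjective s, hφ⟩
  · rw [← D.quotientLin_one s, hφ, map_one]
  · intro a b
    obtain ⟨a, rfl⟩ := D.quotientLin_surjective s a
    obtain ⟨b, rfl⟩ := D.quotientLin_surjective s b
    rw [← quotientLin_mul, hφ, hφ, hφ, map_mul]

end QuotientDatum

end

noncomputable section

/-! ### From the largest kernel to the Hopf image of ρ_q. -/

section HopfImageOfRho

open TwistedSmash

variable {k : Type u} [Field k] {q : kˣ}

/-- Largest kernel means finality: p₀ descends along every competing surjection, and surjectivity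
gives uniqueness and compatibility with the maps to matrices. -/
theorem IsHopfFactorization.isHopfImage {Q : Type*} [Group Q]
    {act : Multiplicative (ZMod 2) →* MulAut Q} {c : SmashCocycle k act}
    {p₀ : SmashCoproduct k (cyclicAct 2 2) →ₐc[k] TwistedSmash c}
    {φ₀ : TwistedSmash c →ₐ[k] Matrix (ZMod 2) (ZMod 2) k}
    (h₀ : IsHopfFactorization (rho q) p₀ φ₀) (j : Q → Gamma 2 2)
    (hj : ∀ a y, p₀ (elt _ (j a) y) = elt c a y)
    (hinj : ∀ σ a b, rowEntry q σ (j a) ≠ 0 →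
      rowEntry q σ (j b) ^ 2 = rowEntry q σ (j a) ^ 2 → b = a) :
    IsHopfImage (rho q) p₀ φ₀ := by
  refine ⟨h₀, fun L' _ _ p ψ h => ?_⟩
  obtain ⟨f, hf⟩ := BialgHom.exists_lift p h.1 p₀ fun x hx => h₀.map_eq_zero j hj hinj h hx
  refine ⟨f, ⟨hf, fun b => ?_⟩, fun g hg => ?_⟩
  · obtain ⟨a, rfl⟩ := h.1 b
    rw [hf, h₀.2, h.2]
  · ext b
    obtain ⟨a, rfl⟩ := h.1 b
    rw [hf, hg.1]

/-- Finality of A gives a map from the twisted smash coproduct to A, injective by the kernel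
comparison and surjective because p is. Taking `Q : Type` puts the source in the universe over which
`IsHopfImage` quantifies, while A may live in any universe. -/
theorem IsHopfFactorization.nonempty_bialgEquiv {Q : Type} [Group Q]
    {act : Multiplicative (ZMod 2) →* MulAut Q} {c : SmashCocycle k act}
    {p₀ : SmashCoproduct k (cyclicAct 2 2) →ₐc[k] TwistedSmash c}
    {φ₀ : TwistedSmash c →ₐ[k] Matrix (ZMod 2) (ZMod 2) k}
    (h₀ : IsHopfFactorization (rho q) p₀ φ₀) (j : Q → Gamma 2 2)
    (hj : ∀ a y, p₀ (elt _ (j a) y) = elt c a y)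
    (hinj : ∀ σ a b, rowEntry q σ (j a) ≠ 0 →
      rowEntry q σ (j b) ^ 2 = rowEntry q σ (j a) ^ 2 → b = a)
    {A : Type v} [Ring A] [HopfAlgebra k A] {p : SmashCoproduct k (cyclicAct 2 2) →ₐc[k] A}
    {φ : A →ₐ[k] Matrix (ZMod 2) (ZMod 2) k} (h : IsHopfImage (rho q) p φ) :
    Nonempty (A ≃ₐc[k] TwistedSmash c) := by
  obtain ⟨f, ⟨hf, -⟩, -⟩ := h.2 (TwistedSmash c) p₀ φ₀ h₀
  refine ⟨(BialgEquiv.ofBijective f ⟨?_, fun a => ?_⟩).symm⟩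
  · rw [injective_iff_map_eq_zero]
    intro b hb
    obtain ⟨x, rfl⟩ := h₀.1 b
    exact h₀.map_eq_zero j hj hinj h.1 (by rw [← hf, hb])
  · obtain ⟨x, rfl⟩ := h.1.1 a
    exact ⟨p₀ x, hf x⟩

/-- The projection of `k[Γ_{2,2}] ⋊ k^{ℤ_2}` attached to a quotient datum on which the
representation restricts to the scalars `Φ`, is the Hopf image of `ρ_q`. -/
theorem QuotientDatum.hopfImage (D : QuotientDatum k (cyclicAct 2 2))
    (s : NormalizedSection D.N) (hN : D.N = rotSubgroup (orderOf (q ^ 4)))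
    (hD : ∀ r : D.N, (gammaRep q r : Matrix (ZMod 2) (ZMod 2) k)
      = algebraMap k _ (D.Φ r (Multiplicative.ofAdd 1))) :
    (∃ φ, IsHopfImage (rho q) (D.quotientHom s) φ) ∧
      ∀ (A : Type v) [Ring A] [HopfAlgebra k A] (p : SmashCoproduct k (cyclicAct 2 2) →ₐc[k] A)
        (φ : A →ₐ[k] Matrix (ZMod 2) (ZMod 2) k), IsHopfImage (rho q) p φ →
          Nonempty (A ≃ₐc[k] TwistedSmash (D.cocycle s)) := by
  obtain ⟨φ₀, h₀⟩ := D.exists_factorization s ((Units.coeHom _).comp (gammaRep q))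
    (Multiplicative.ofAdd 1) hD
  have hinj : ∀ σ a b, rowEntry q σ (s.j a) ≠ 0 →
      rowEntry q σ (s.j b) ^ 2 = rowEntry q σ (s.j a) ^ 2 → b = a := by
    intro σ a b h1 h2
    have := mem_rotSubgroup_of_rowEntry q h1 h2
    rw [← hN, ← QuotientGroup.eq_one_iff, QuotientGroup.mk_mul, QuotientGroup.mk_inv, s.mk_j,
      s.mk_j] at this
    exact mul_inv_eq_one.1 this
  exact ⟨⟨φ₀, IsHopfFactorization.isHopfImage h₀ s.j (D.quotientHom_section s) hinj⟩,
    fun A _ _ p φ h =>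
      IsHopfFactorization.nonempty_bialgEquiv h₀ s.j (D.quotientHom_section s) hinj h⟩

variable (k) in
/-- The quotient datum `(N_m, 1)`. -/
def trivialRotDatum (m : ℕ) : QuotientDatum k (cyclicAct 2 2) where
  N := rotSubgroup m
  normal := rotSubgroup_normal m
  stable := rotSubgroup_stable m
  Φ := 1
  Φ_mul _ _ _ := by simp
  Φ_conj _ _ := rfl

/-- The matrix of `rot ^ m` is diag(q^(2m), q^(−2m)), which is scalar as soon as q^(2m) is its own
inverse. -/
theorem gammaRep_rot_pow_zpow {m : ℕ} (h : (q ^ (2 * m))⁻¹ = q ^ (2 * m)) (n : ℤ) :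
    (gammaRep q ((rot ^ m) ^ n) : Matrix (ZMod 2) (ZMod 2) k)
      = algebraMap k _ (((q ^ (2 * m)) ^ n : kˣ) : k) := by
  have e : q ^ (2 * (m * n : ℤ)) = (q ^ (2 * m)) ^ n := by
    rw [← zpow_natCast, ← zpow_mul]
    congr 1
    push_cast
    ring
  rw [← zpow_natCast, ← zpow_mul, gammaRep_rot_zpow, zpow_neg, e, ← inv_zpow, h]
  simp only [ite_self]
  rfl

theorem trivialRotDatum_scalar {m : ℕ} (h : q ^ (2 * m) = 1) (r : (trivialRotDatum k m).N) :
    (gammaRep q r : Matrix (ZMod 2) (ZMod 2) k)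
      = algebraMap k _ ((trivialRotDatum k m).Φ r (Multiplicative.ofAdd 1)) := by
  obtain ⟨_, n, rfl⟩ := r
  refine (gammaRep_rot_pow_zpow (by rw [h, inv_one]) n).trans ?_
  rw [h, one_zpow]
  rfl

theorem rotDatum_scalar {m : ℕ} (hm : 0 < m) (h : q ^ (2 * m) = -1) (r : (rotDatum k hm).N) :
    (gammaRep q r : Matrix (ZMod 2) (ZMod 2) k)
      = algebraMap k _ ((rotDatum k hm).Φ r (Multiplicative.ofAdd 1)) := by
  obtain ⟨_, n, rfl⟩ := r
  refine (gammaRep_rot_pow_zpow (by rw [h, inv_neg_one]) n).trans ?_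
  have e : (rotDatum k hm).Φ ⟨(rot ^ m) ^ n, ⟨n, rfl⟩⟩ = chi k ^ n := rotPhi_zpow k hm n _
  have e' : chi k (Multiplicative.ofAdd 1) = -1 := if_neg (by decide)
  rw [h, ← e', ← Pi.pow_apply, ← e]

/-- The bialgebra `k[Γ_{2,2} / N_m] ⊗ k^{ℤ_2}`, with any structure constants, has dimension
`4 m`. -/
theorem finrank_twistedSmash_rot {m : ℕ} (hm : 0 < m)
    {act : Multiplicative (ZMod 2) →* MulAut (Gamma 2 2 ⧸ rotSubgroup m)}
    (c : SmashCocycle k act) :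
    Module.Finite k (TwistedSmash c) ∧ Module.finrank k (TwistedSmash c) = 4 * m := by
  have hc : Nat.card (Gamma 2 2 ⧸ rotSubgroup m) = 2 * m := index_rotSubgroup m
  have : Finite (Gamma 2 2 ⧸ rotSubgroup m) := Nat.finite_of_card_ne_zero (by omega)
  refine ⟨Module.Finite.of_basis (basis c), ?_⟩
  have h2 : Nat.card (Multiplicative (ZMod 2)) = 2 := Nat.card_zmod 2
  rw [Module.finrank_eq_nat_card_basis (basis c), Nat.card_prod, hc, h2]
  ring

theorem not_finite_smashCoproduct :
    ¬ Module.Finite k (SmashCoproduct k (cyclicAct 2 2)) := by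
  intro h
  have := Module.Finite.finite_basis (basis (smashDatum k (cyclicAct 2 2)))
  have : Finite (Gamma 2 2) := Finite.prod_left (Multiplicative (ZMod 2))
  have : Finite ℤ := Finite.of_injective _ (rot_pow_injective one_pos)
  exact not_finite ℤ

variable (q) in
theorem pow_two_mul_orderOf : q ^ (2 * orderOf (q ^ 4)) = 1 ∨ q ^ (2 * orderOf (q ^ 4)) = -1 := by
  rw [← Units.inv_eq_self_iff, inv_eq_iff_mul_eq_one, ← pow_add, ← add_mul, pow_mul]
  exact pow_orderOf_eq_one _

end HopfImageOfRho

end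

/-- Existence and description of the Hopf image `A_q` of `ρ_q` over a field of characteristic zero;
`orderOf q` is the order `m` of `q` (and is `0` if `q` has infinite order). -/
theorem proposition5p8 {k : Type u} [Field k] [CharZero k] (q : kˣ) :
    (∃ (L : Type u) (_ : Ring L) (_ : HopfAlgebra k L)
      (p : SmashCoproduct k (cyclicAct 2 2) →ₐc[k] L) (φ : L →ₐ[k] Matrix (ZMod 2) (ZMod 2) k),
      IsHopfImage (rho q) p φ) ∧
    ∀ (A : Type v) [Ring A] [HopfAlgebra k A]
      (p : SmashCoproduct k (cyclicAct 2 2) →ₐc[k] A) (φ : A →ₐ[k] Matrix (ZMod 2) (ZMod 2) k),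
      IsHopfImage (rho q) p φ →
        (¬ IsOfFinOrder q → Nonempty (A ≃ₐc[k] SmashCoproduct k (cyclicAct 2 2))) ∧
        (Odd (orderOf q) → Nonempty (A ≃ₐc[k] HopfA k (orderOf q))) ∧
        (orderOf q % 4 = 2 → Nonempty (A ≃ₐc[k] HopfA k (orderOf q / 2))) ∧
        (∀ (n : ℕ) (hn : 0 < n) (s : NormalizedSection (rotSubgroup n)),
          orderOf q = 4 * n → Nonempty (A ≃ₐc[k] HopfB k hn s)) ∧
        (IsOfFinOrder (q ^ 4) → Module.Finite k A ∧ Module.finrank k A = 4 * orderOf (q ^ 4)) ∧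
        (¬ IsOfFinOrder (q ^ 4) → ¬ Module.Finite k A) := by
  -- The one use of the characteristic: 1 ≠ −1 rules out m = 0, the value of `orderOf` for infinite
  -- order.
  have not_one : ∀ m : ℕ, q ^ (2 * m) = -1 → 0 < m := by
    rintro (_ | m) h
    · exact absurd (congrArg Units.val h) (by norm_num)
    · exact m.succ_pos
  refine ⟨?_, fun A _ _ p φ h => ?_⟩
  -- Infinite order is included: M = 0, N_0 is trivial, and the sign is +1.
  · obtain ⟨s⟩ := NormalizedSection.nonempty (rotSubgroup (orderOf (q ^ 4)))
    rcases pow_two_mul_orderOf q with hq | hq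
    · obtain ⟨φ, hφ⟩ := (QuotientDatum.hopfImage.{u, u} (trivialRotDatum k _) s rfl
        (trivialRotDatum_scalar hq)).1
      exact ⟨_, _, _, _, φ, hφ⟩
    · obtain ⟨φ, hφ⟩ := (QuotientDatum.hopfImage.{u, u} (rotDatum k (not_one _ hq)) s rfl
        (rotDatum_scalar _ hq)).1
      exact ⟨_, _, _, _, φ, hφ⟩
  have isoA : ∀ m, m = orderOf (q ^ 4) → q ^ (2 * m) = 1 → Nonempty (A ≃ₐc[k] HopfA k m) := by
    intro m hm hq
    obtain ⟨s⟩ := NormalizedSection.nonempty (rotSubgroup m)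
    obtain ⟨e⟩ := ((trivialRotDatum k m).hopfImage s (congrArg rotSubgroup hm)
      (trivialRotDatum_scalar hq)).2 A p φ h
    -- For trivial Φ the structure constants of the twisted quotient are definitionally those of the
    -- smash coproduct, whatever the section.
    exact ⟨e⟩
  have isoB : ∀ (m : ℕ) (hm : 0 < m) (s : NormalizedSection (rotSubgroup m)),
      m = orderOf (q ^ 4) → q ^ (2 * m) = -1 → Nonempty (A ≃ₐc[k] HopfB k hm s) :=
    fun m hm s e hq => ((rotDatum k hm).hopfImage s (congrArg rotSubgroup e)
      (rotDatum_scalar hm hq)).2 A p φ h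
  have isoK : orderOf (q ^ 4) = 0 → Nonempty (A ≃ₐc[k] SmashCoproduct k (cyclicAct 2 2)) := by
    intro hq
    refine IsHopfFactorization.nonempty_bialgEquiv (q := q) (p₀ := BialgHom.id k _) (φ₀ := rho q)
      ⟨Function.surjective_id, fun _ => rfl⟩ id (fun _ _ => rfl) (fun σ a b h1 h2 => ?_) h
    have := mem_rotSubgroup_of_rowEntry q h1 h2
    rw [hq, rotSubgroup, pow_zero, Subgroup.zpowers_one_eq_bot, Subgroup.mem_bot] at this
    exact mul_inv_eq_one.1 this
  have ord : orderOf (q ^ 4) = orderOf q / (orderOf q).gcd 4 := orderOf_pow' q (by norm_num)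
  refine ⟨fun hq => isoK ?_, fun hq => isoA _ ?_ ?_, fun hq => isoA _ ?_ ?_,
    fun n hn s hq => isoB n hn s ?_ ?_, fun hq => ?_, fun hq hA => ?_⟩
  · rw [ord, orderOf_eq_zero hq, Nat.zero_div]
  · have : (orderOf q).gcd 4 = 1 := (hq.coprime_two_right).pow_right 2
    rw [ord, this, Nat.div_one]
  · rw [mul_comm, pow_mul, pow_orderOf_eq_one, one_pow]
  · have : (orderOf q).gcd 4 = 2 := by rw [Nat.gcd_comm, Nat.gcd_rec, hq]; rfl
    rw [ord, this]
  · rw [Nat.mul_div_cancel' (by omega), pow_orderOf_eq_one]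
  · rw [ord, hq, Nat.gcd_eq_right (dvd_mul_right 4 n), Nat.mul_div_cancel_left _ (by norm_num)]
  · have e : n = orderOf (q ^ 4) := by
      rw [ord, hq, Nat.gcd_eq_right (dvd_mul_right 4 n), Nat.mul_div_cancel_left _ (by norm_num)]
    have h2 := pow_two_mul_orderOf q
    rw [← e] at h2
    -- The sign is −1 here: q^(2n) = 1 would force the order 4n to divide 2n.
    refine h2.resolve_left fun h1 => ?_
    have := Nat.le_of_dvd (by omega) (orderOf_dvd_of_pow_eq_one h1)
    omega
  · have hpos : 0 < orderOf (q ^ 4) := hq.orderOf_pos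
    have transfer : ∀ {act : Multiplicative (ZMod 2) →*
        MulAut (Gamma 2 2 ⧸ rotSubgroup (orderOf (q ^ 4)))} {c : SmashCocycle k act},
        Nonempty (A ≃ₐc[k] TwistedSmash c) →
          Module.Finite k A ∧ Module.finrank k A = 4 * orderOf (q ^ 4) := by
      rintro act c ⟨e⟩
      obtain ⟨h1, h2⟩ := finrank_twistedSmash_rot hpos c
      let e' : A ≃ₗ[k] TwistedSmash c := (e : A ≃ₐ[k] TwistedSmash c).toLinearEquiv
      exact ⟨Module.Finite.equiv e'.symm, by rw [e'.finrank_eq, h2]⟩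
    rcases pow_two_mul_orderOf q with hq | hq
    · exact transfer (isoA _ rfl hq)
    · obtain ⟨s⟩ := NormalizedSection.nonempty (rotSubgroup (orderOf (q ^ 4)))
      exact transfer (isoB _ hpos s rfl hq)
  · obtain ⟨e⟩ := isoK (orderOf_eq_zero hq)
    exact not_finite_smashCoproduct (k := k)
      (Module.Finite.equiv (e : A ≃ₐ[k] SmashCoproduct k (cyclicAct 2 2)).toLinearEquiv)
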